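/- **Theorem (Convergence of MC-PseudoLabel for $\mathcal H_{2,\Phi}$).** Let $X=(\Phi,\Psi)$ with $\Phi\in\mathbb R^{p}$, $\Psi\in\mathbb R^{q}$, let $Y\in\mathbb R$, and let $D$ be the distribution of $(X,Y)$. Assume that $(\Phi,\Psi,Y)\sim\mathcal N(\mu,\Sigma)$ with $\Sigma$ positive definite, with blocks $\Sigma_{\Phi\Phi},\Sigma_{\Phi\Psi},\Sigma_{\Phi y},\dots,\Sigma_{yy}$. Put $$ M(\Sigma)=(\Sigma_{yy}-\Sigma_{y\Phi}\Sigma_{\Phi\Phi}^{-1}\Sigma_{\Phi y})^{-1}(\Sigma_{y\Psi}-\Sigma_{y\Phi}\Sigma_{\Phi\Phi}^{-1}\Sigma_{\Phi\Psi})(\Sigma_{\Psi\Psi}-\Sigma_{\Psi\Phi}\Sigma_{\Phi\Phi}^{-1}\Sigma_{\Phi\Psi})^{-1}(\Sigma_{\Psi y}-\Sigma_{\Psi\Phi}\Sigma_{\Phi\Phi}^{-1}\Sigma_{\Phi y}). $$ Let $\mathcal H_{2,\Phi}$ be the set of continuous integrable functions $h(x,y)$ such that $\mathbb E[h(X,Y)\mid\Phi,Y]$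 is almost surely constant, let $$\mathcal H=\{h\in\mathcal H_{2,\Phi}: h(x,y)=c_x^{T}x+c_y y+c_b,\ c_x\in\mathbb R^{p+q},\ c_y,c_b\in\mathbb R\},$$ and let $\mathcal F$ be the class of all (Borel) functions $\mathbb R^{p+q}\to\mathbb R$. A *run of MC-PseudoLabel$(D,\mathcal H,\mathcal F)$ without rounding* started at $\mathbb E[Y\mid X]$ is a sequence $f^{(0)},f^{(1)},\dots\in\mathcal F$ with $f^{(0)}(X)=\mathbb E[Y\mid X]$ almost surely such that for every $t\ge 0$ there are $h^t_v\in\mathcal H$ $(v\in\mathbb R)$ with: * for almost every value $v$ of $f^{(t)}(X)$, $\;h^t_v\in\arg\min_{h\in\mathcal H}\mathbb E\big[(h(X,Y)-Y)^2\mid f^{(t)}(X)=v\big]$; * $f^{(t+1)}\in\arg\min_{g\in\mathcal F}\mathbb E\big[(g(X)-\tilde f^{(t+1)}(X,Y))^2\big]$, where $\tilde f^{(t+1)}(x,y)=h^t_{f^{(t)}(x)}(x,y)$. Then $0\le M(\Sigma)<1$. Moreover, if the variables are in general position in the sense that $\Sigma_{\Phi y}\neq 0$ unless $\Sigma_{\Psi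 y}=0$ also holds, then such a run exists, and there is a constant $C$, depending only on $D$, such that for every such run and every version $x\mapsto\mathbb E[Y\mid\Phi(x)]$ of the conditional expectation, for almost every $x$, $$ f^{(t)}(x)\to\mathbb E[Y\mid\Phi(x)]\ (t\to\infty),\qquad \big|f^{(t)}(x)-\mathbb E[Y\mid\Phi(x)]\big|\le C\,(1+\|x\|)\,M(\Sigma)^t\quad\text{for all } t\ge 0 . $$ -/

import Mathlib

open MeasureTheory ProbabilityTheory Filter Topology
open scoped ENNReal

noncomputable section

/-! ### Grouping functions -/

/-- The class `H_{2,Φ}` of the distribution `D` of `(X, Y)`, for a representation `Φ` of the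
covariates: continuous (integrable) functions `h(x, y)` whose conditional expectation
`E[h(X, Y) | Φ(X), Y]` is almost surely equal to a constant. -/
def H2 {𝒳 𝒮 : Type*} [TopologicalSpace 𝒳] [MeasurableSpace 𝒳] [MeasurableSpace 𝒮]
    (D : Measure (𝒳 × ℝ)) (Φ : 𝒳 → 𝒮) : Set (𝒳 × ℝ → ℝ) :=
  {h | Continuous h ∧ Integrable h D ∧
    ∃ C : ℝ,
      D[h | MeasurableSpace.comap (fun z : 𝒳 × ℝ => (Φ z.1, z.2)) inferInstance]
        =ᵐ[D] fun _ => C}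

/-! ### The algorithm MC-PseudoLabel, without rounding, on a distribution `D` -/

/-- Expected squared deviation of the function `f` from the label function `ℓ` under `Q`. -/
def sqRisk {𝒵 : Type*} [MeasurableSpace 𝒵] (Q : Measure 𝒵) (f ℓ : 𝒵 → ℝ) : ℝ≥0∞ :=
  ∫⁻ z, ENNReal.ofReal ((f z - ℓ z) ^ 2) ∂Q

/-- `f` is a least-squares regression of the label `ℓ` under `Q` in the class `F`, i.e. a
possible output of the regression oracle: `f ∈ argmin_{g ∈ F} E_Q[(g - ℓ)²]`. -/
def IsRegression {𝒵 : Type*} [MeasurableSpace 𝒵] (Q : Measure 𝒵) (F : Set (𝒵 → ℝ))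
    (ℓ f : 𝒵 → ℝ) : Prop :=
  f ∈ F ∧ ∀ g ∈ F, sqRisk Q f ℓ ≤ sqRisk Q g ℓ

/-- The law of `(X, Y) ∼ D` conditioned on the level set `f(X) = v`. -/
def levelSetLaw {𝒳 : Type*} [MeasurableSpace 𝒳] [StandardBorelSpace 𝒳] [Nonempty 𝒳]
    (D : Measure (𝒳 × ℝ)) [IsFiniteMeasure D] (f : 𝒳 → ℝ) (v : ℝ) : Measure (𝒳 × ℝ) :=
  condDistrib (fun z : 𝒳 × ℝ => z) (fun z : 𝒳 × ℝ => f z.1) D v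

/-- One iteration from the model `f` to the model `f'`. On the level set `f(X) = v`, for almost
every value `v` of `f(X)`, the label `y` is regressed with grouping functions, giving `h v`.
Then `f'` is the regression in `F` of the pseudolabels `(x, y) ↦ h (f x) (x, y)`. -/
def MCPseudolabelStep {𝒳 : Type*} [MeasurableSpace 𝒳] [StandardBorelSpace 𝒳] [Nonempty 𝒳]
    (D : Measure (𝒳 × ℝ)) [IsFiniteMeasure D] (H : Set (𝒳 × ℝ → ℝ)) (F : Set (𝒳 → ℝ))
    (f f' : 𝒳 → ℝ) : Prop :=
  ∃ h : ℝ → 𝒳 × ℝ → ℝ,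
    (∀ v, h v ∈ H) ∧
    (∀ᵐ v ∂(D.map fun z => f z.1), IsRegression (levelSetLaw D f v) H (fun z => z.2) (h v)) ∧
    f' ∈ F ∧
    ∀ g ∈ F, sqRisk D (fun z => f' z.1) (fun z => h (f z.1) z) ≤
      sqRisk D (fun z => g z.1) (fun z => h (f z.1) z)

/-- `f 0, f 1, …` are the models of a run of MC-PseudoLabel without rounding that starts from
the model `E[Y | X]` and is iterated indefinitely. -/
def IsMCPseudolabelRun {𝒳 : Type*} [MeasurableSpace 𝒳] [StandardBorelSpace 𝒳] [Nonempty 𝒳]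
    (D : Measure (𝒳 × ℝ)) [IsFiniteMeasure D] (H : Set (𝒳 × ℝ → ℝ)) (F : Set (𝒳 → ℝ))
    (f : ℕ → 𝒳 → ℝ) : Prop :=
  f 0 ∈ F ∧
  (fun z : 𝒳 × ℝ => f 0 z.1)
    =ᵐ[D] D[fun z : 𝒳 × ℝ => z.2 |
      MeasurableSpace.comap (fun z : 𝒳 × ℝ => z.1) inferInstance] ∧
  ∀ t, MCPseudolabelStep D H F (f t) (f (t + 1))

/-! ### The Gaussian setting: `X = (Φ, Ψ)` with `Φ` in `ℝ^p` and `Ψ` in `ℝ^q` -/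

/-- The covariate space `ℝ^p × ℝ^q`. -/
abbrev Covariates (p q : ℕ) : Type := EuclideanSpace ℝ (Fin p) × EuclideanSpace ℝ (Fin q)

/-- Coordinates of `(Φ, Ψ, Y)`. -/
abbrev JointIdx (p q : ℕ) : Type := Fin p ⊕ (Fin q ⊕ Unit)

/-- The coordinates of the block `Φ`. -/
def idxΦ {p q : ℕ} : Fin p → JointIdx p q := fun i => Sum.inl i

/-- The coordinates of the block `Ψ`. -/
def idxΨ {p q : ℕ} : Fin q → JointIdx p q := fun j => Sum.inr (Sum.inl j)

/-- The coordinate `Y`. -/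
def idxY {p q : ℕ} : Unit → JointIdx p q := fun u => Sum.inr (Sum.inr u)

/-- The point `((φ, ψ), y)` as the vector `(φ, ψ, y)` of `ℝ^{p+q+1}`. -/
def jointVec {p q : ℕ} (z : Covariates p q × ℝ) : EuclideanSpace ℝ (JointIdx p q) :=
  WithLp.toLp 2 (Sum.elim (fun i => z.1.1 i) (Sum.elim (fun j => z.1.2 j) (fun _ => z.2)))

/-- `S_{ab} - S_{aΦ} S_{ΦΦ}⁻¹ S_{Φb}` for the blocks of rows `a` and columns `b`. -/
def schurΦ {p q : ℕ} {m n : Type*} (S : Matrix (JointIdx p q) (JointIdx p q) ℝ)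
    (a : m → JointIdx p q) (b : n → JointIdx p q) : Matrix m n ℝ :=
  S.submatrix a b - S.submatrix a idxΦ * (S.submatrix idxΦ idxΦ)⁻¹ * S.submatrix idxΦ b

/-- The ratio `M(Σ)`, a `1 × 1` matrix product read as a real number. -/
def ratioM {p q : ℕ} (S : Matrix (JointIdx p q) (JointIdx p q) ℝ) : ℝ :=
  ((schurΦ S idxY idxY)⁻¹ * schurΦ S idxY idxΨ * (schurΦ S idxΨ idxΨ)⁻¹ *
    schurΦ S idxΨ idxY) () ()

/-- The linear grouping functions in `H_{2,Φ}`, where `Φ` is the first block of covariates. -/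
def linearH2 {p q : ℕ} (D : Measure (Covariates p q × ℝ)) : Set (Covariates p q × ℝ → ℝ) :=
  {h | h ∈ H2 D (fun x : Covariates p q => x.1) ∧
    ∃ (cΦ : EuclideanSpace ℝ (Fin p)) (cΨ : EuclideanSpace ℝ (Fin q)) (cy cb : ℝ),
      ∀ z, h z = inner ℝ cΦ z.1.1 + inner ℝ cΨ z.1.2 + cy * z.2 + cb}

/-- The predictor class of all (Borel) functions of the covariates. -/
def allPredictors (𝒳 : Type*) [MeasurableSpace 𝒳] : Set (𝒳 → ℝ) := {f | Measurable f}

end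

/-!
Write `⟨·, ·⟩` for the covariance of linear statistics of the Gaussian vector `(Φ, Ψ, Y)`, and
`E[Y | Φ] = E[Y] + γ`, `Y = E[Y] + γ + ε`, `E[Y | X] = E[Y] + γ + δ`. Then `γ` is orthogonal to `ε`
and `δ`, the residual `ε - δ` is orthogonal to all statistics of `X`, and
`M = |δ|² / |ε|² = ⟨δ, ε⟩ / |ε|²`. So regression on `X` sends `ε` to `δ`, regression on `(Φ, Y)`
sends `δ` to `M ε`, and `M < 1` because `ε ≠ δ`.

Let `Rⱼ` be the residual of `Ψⱼ` after regression on `(Φ, Y)`. The linear grouping functions are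
the affine functions of `R` (`mem_linearH2_iff`). Suppose that a model is `f = E[Y] + u + θ · R`
with `u` a linear statistic of `(Φ, Y)`, and let `λ u` be the regression of `Y` on `u`. The
residual `Y - E[Y] - λ u` is orthogonal to `u` and to `R`, hence independent of `(f, R)`. Therefore
`E[Y] + λ u` is the best predictor of `Y` among the functions of `(f, R)`; on the level set `f = v`
it equals `E[Y] + λ (v - E[Y] - θ · R)`, which is a grouping function. It is the only minimizer as
long as `R` is not degenerate on the level set, that is, unless `u = 0 ≠ θ`
(`isRegression_levelSetLaw_iff`). The next model is then `E[Y] + λ u'`, with `u'` the regression of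
`u` on `X` (`mcPseudolabelStep_iff`).

Along a run the model is `E[Y] + a (γ + Mᵗ δ)`, with `u = a (γ + Mᵗ⁺¹ ε)` and
`u' = a (γ + Mᵗ⁺¹ δ)`. Computing `λ` shows that the scale `a` is
`Aₜ = (|γ|² + Mᵗ |ε|²) / (|γ|² + M²ᵗ |ε|²)` (`isMCPseudolabelRun_iff`). If `γ ≠ 0` then
`|Aₜ - 1| ≤ Mᵗ |ε|² / |γ|²`, which gives the rate. If `γ = 0`, general position makes `δ` vanish
too, and every model is the constant `E[Y]`.
-/

/-! ### Linear statistics of a Gaussian vector -/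

noncomputable section

variable {p q : ℕ}

/-- The covariance form `(w, w') ↦ wᵀ S w'` on coefficient vectors. -/
abbrev covForm (S : Matrix (JointIdx p q) (JointIdx p q) ℝ) :
    LinearMap.BilinForm ℝ (JointIdx p q → ℝ) := Matrix.toBilin' S

/-- The coefficient vector of a single coordinate. -/
abbrev coordVec (k : JointIdx p q) : JointIdx p q → ℝ := Pi.single k 1

/-- The centred linear statistic `∑ₖ wₖ (Zₖ - μₖ)` of `Z = (Φ, Ψ, Y)`. -/
def linStat (μ : EuclideanSpace ℝ (JointIdx p q)) :
    (JointIdx p q → ℝ) →ₗ[ℝ] (Covariates p q × ℝ → ℝ) where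
  toFun w z := ∑ k, w k * (jointVec z k - μ k)
  map_add' w w' := by ext z; simp [add_mul, Finset.sum_add_distrib]
  map_smul' c w := by
    ext z
    simp only [Pi.smul_apply, smul_eq_mul, RingHom.id_apply, Finset.mul_sum, mul_assoc]

lemma linStat_apply (μ : EuclideanSpace ℝ (JointIdx p q)) (w : JointIdx p q → ℝ)
    (z : Covariates p q × ℝ) :
    linStat μ w z = ∑ k, w k * (jointVec z k - μ k) := rfl

lemma linStat_coordVec (μ : EuclideanSpace ℝ (JointIdx p q)) (k : JointIdx p q)
    (z : Covariates p q × ℝ) : linStat μ (coordVec k) z = jointVec z k - μ k := by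
  simp [linStat_apply, Pi.single_apply]

lemma linStat_coordVec_idxY (μ : EuclideanSpace ℝ (JointIdx p q)) (z : Covariates p q × ℝ) :
    linStat μ (coordVec (idxY ())) z = z.2 - μ (idxY ()) := by
  simp [linStat_coordVec, jointVec, idxY]

lemma linStat_sum_smul (μ : EuclideanSpace ℝ (JointIdx p q)) {κ : Type*} [Fintype κ]
    (c : κ → ℝ) (w : κ → JointIdx p q → ℝ) (z : Covariates p q × ℝ) :
    linStat μ (∑ j, c j • w j) z = ∑ j, c j * linStat μ (w j) z := by
  simp [map_sum, Finset.sum_apply]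

lemma continuous_jointVec : Continuous (jointVec : Covariates p q × ℝ → _) := by
  refine (PiLp.continuous_toLp 2 _).comp (continuous_pi ?_)
  rintro (i | j | u) <;> simp only [Sum.elim_inl, Sum.elim_inr] <;> fun_prop

lemma continuous_linStat (μ : EuclideanSpace ℝ (JointIdx p q)) (w : JointIdx p q → ℝ) :
    Continuous (linStat μ w) := by
  have h (k : JointIdx p q) : Continuous fun z : Covariates p q × ℝ => jointVec z k :=
    (EuclideanSpace.proj k : EuclideanSpace ℝ (JointIdx p q) →L[ℝ] ℝ).continuous.comp
      continuous_jointVec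
  change Continuous fun z => ∑ k, w k * (jointVec z k - μ k)
  exact continuous_finsetSum _ fun k _ => (continuous_const (y := w k)).mul
    ((h k).sub (continuous_const (y := μ k)))

lemma measurable_linStat (μ : EuclideanSpace ℝ (JointIdx p q)) (w : JointIdx p q → ℝ) :
    Measurable (linStat μ w) := (continuous_linStat μ w).measurable

lemma covForm_symm {S : Matrix (JointIdx p q) (JointIdx p q) ℝ} (hS : S.PosDef)
    (w w' : JointIdx p q → ℝ) : covForm S w w' = covForm S w' w := by
  have h : S.transpose = S := by simpa using hS.1.eq
  rw [covForm, Matrix.toBilin'_apply', Matrix.toBilin'_apply', dotProduct_comm,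
    ← Matrix.vecMul_transpose, h, ← Matrix.dotProduct_mulVec]

lemma covForm_self_pos {S : Matrix (JointIdx p q) (JointIdx p q) ℝ} (hS : S.PosDef)
    {w : JointIdx p q → ℝ} (hw : w ≠ 0) : 0 < covForm S w w := by
  simpa [covForm, Matrix.toBilin'_apply'] using hS.dotProduct_mulVec_pos hw

lemma covForm_self_nonneg {S : Matrix (JointIdx p q) (JointIdx p q) ℝ} (hS : S.PosDef)
    (w : JointIdx p q → ℝ) : 0 ≤ covForm S w w := by
  rcases eq_or_ne w 0 with rfl | hw
  · simp
  · exact (covForm_self_pos hS hw).le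

lemma covForm_self_eq_zero {S : Matrix (JointIdx p q) (JointIdx p q) ℝ} (hS : S.PosDef)
    {w : JointIdx p q → ℝ} (hw : covForm S w w = 0) : w = 0 := by
  by_contra h
  exact (covForm_self_pos hS h).ne' hw

variable {μ : EuclideanSpace ℝ (JointIdx p q)} {S : Matrix (JointIdx p q) (JointIdx p q) ℝ}
  {D : Measure (Covariates p q × ℝ)}

lemma hasGaussianLaw_jointVec (hD : D.map jointVec = multivariateGaussian μ S) :
    HasGaussianLaw (jointVec : Covariates p q × ℝ → _) D where
  isGaussian_map := by rw [hD]; infer_instance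

lemma hasGaussianLaw_coord (hD : D.map jointVec = multivariateGaussian μ S) (k : JointIdx p q) :
    HasGaussianLaw (fun z => jointVec z k) D :=
  (hasGaussianLaw_jointVec hD).map_fun (EuclideanSpace.proj k)

lemma integral_coord (hD : D.map jointVec = multivariateGaussian μ S) (k : JointIdx p q) :
    ∫ z, jointVec z k ∂D = μ k := by
  have h := integral_map (μ := D) continuous_jointVec.measurable.aemeasurable
    (f := fun x : EuclideanSpace ℝ (JointIdx p q) => x k) (by fun_prop)
  rw [← h, hD]
  have h2 := ContinuousLinearMap.integral_comp_id_comm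
    (μ := multivariateGaussian μ S) IsGaussian.integrable_id
    (EuclideanSpace.proj k : EuclideanSpace ℝ (JointIdx p q) →L[ℝ] ℝ)
  simpa using h2

lemma covariance_coord (hS : S.PosDef) (hD : D.map jointVec = multivariateGaussian μ S)
    (k l : JointIdx p q) : cov[fun z => jointVec z k, fun z => jointVec z l; D] = S k l := by
  have h := covariance_map_fun (μ := D) (Z := jointVec)
    (X := fun x : EuclideanSpace ℝ (JointIdx p q) => x k) (Y := fun x => x l)
    (by fun_prop) (by fun_prop) continuous_jointVec.measurable.aemeasurable
  rw [← h, hD, covariance_eval_multivariateGaussian hS.posSemidef]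

lemma memLp_linStat [IsProbabilityMeasure D] (hD : D.map jointVec = multivariateGaussian μ S)
    (w : JointIdx p q → ℝ) : MemLp (linStat μ w) 2 D := by
  change MemLp (fun z => ∑ k, w k * (jointVec z k - μ k)) 2 D
  exact memLp_finsetSum _ fun k _ =>
    (((hasGaussianLaw_coord hD k).memLp_two).sub (memLp_const _)).const_mul _

lemma integrable_linStat [IsProbabilityMeasure D]
    (hD : D.map jointVec = multivariateGaussian μ S)
    (w : JointIdx p q → ℝ) : Integrable (linStat μ w) D :=
  (memLp_linStat hD w).integrable (by norm_num)

lemma integral_linStat [IsProbabilityMeasure D] (hD : D.map jointVec = multivariateGaussian μ S)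
    (w : JointIdx p q → ℝ) : ∫ z, linStat μ w z ∂D = 0 := by
  simp_rw [linStat_apply]
  have hi (k : JointIdx p q) : Integrable (fun z => jointVec z k) D :=
    (hasGaussianLaw_coord hD k).integrable
  have hi' (k : JointIdx p q) : Integrable (fun z => jointVec z k - μ k) D :=
    (hi k).sub (integrable_const _)
  rw [integral_finsetSum _ fun k _ => (hi' k).const_mul _]
  refine Finset.sum_eq_zero fun k _ => ?_
  rw [integral_const_mul, integral_sub (hi k) (integrable_const _), integral_coord hD]
  simp

lemma covariance_linStat [IsProbabilityMeasure D] (hS : S.PosDef)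
    (hD : D.map jointVec = multivariateGaussian μ S) (w w' : JointIdx p q → ℝ) :
    cov[linStat μ w, linStat μ w'; D] = covForm S w w' := by
  have hm (k : JointIdx p q) : MemLp (fun z => jointVec z k - μ k) 2 D :=
    ((hasGaussianLaw_coord hD k).memLp_two).sub (memLp_const _)
  have hi (k : JointIdx p q) : Integrable (fun z => jointVec z k) D :=
    (hasGaussianLaw_coord hD k).integrable
  change cov[fun z => ∑ k, w k * (jointVec z k - μ k),
    fun z => ∑ k, w' k * (jointVec z k - μ k); D] = _
  rw [covariance_fun_sum_fun_sum (fun k => (hm k).const_mul _) (fun k => (hm k).const_mul _),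
    Matrix.toBilin'_apply]
  refine Finset.sum_congr rfl fun k _ => Finset.sum_congr rfl fun l _ => ?_
  rw [covariance_const_mul_left, covariance_const_mul_right,
    covariance_sub_const_left (hi k), covariance_sub_const_right (hi l), covariance_coord hS hD]
  ring

lemma integral_linStat_sq [IsProbabilityMeasure D] (hS : S.PosDef)
    (hD : D.map jointVec = multivariateGaussian μ S) (w : JointIdx p q → ℝ) :
    ∫ z, linStat μ w z ^ 2 ∂D = covForm S w w := by
  rw [← covariance_linStat hS hD, covariance, integral_linStat hD]
  simp [pow_two]

lemma lintegral_linStat_add_const_sq [IsProbabilityMeasure D] (hS : S.PosDef)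
    (hD : D.map jointVec = multivariateGaussian μ S) (w : JointIdx p q → ℝ) (c : ℝ) :
    ∫⁻ z, ENNReal.ofReal ((linStat μ w z + c) ^ 2) ∂D =
      ENNReal.ofReal (covForm S w w + c ^ 2) := by
  have h2 := (memLp_linStat hD w).integrable_sq
  have h1 := integrable_linStat hD w
  have h12 : Integrable (fun z => linStat μ w z ^ 2 + (2 * c) * linStat μ w z) D :=
    h2.add (h1.const_mul _)
  have hsq : (fun z => (linStat μ w z + c) ^ 2) =
      fun z => linStat μ w z ^ 2 + (2 * c) * linStat μ w z + c ^ 2 := by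
    ext z; ring
  have hint : Integrable (fun z => (linStat μ w z + c) ^ 2) D :=
    ((memLp_linStat hD w).add (memLp_const c)).integrable_sq
  rw [← ofReal_integral_eq_lintegral_ofReal hint
    (Eventually.of_forall fun z => sq_nonneg _), hsq,
    integral_add h12 (integrable_const _),
    integral_add h2 (h1.const_mul _), integral_const_mul, integral_linStat hD,
    integral_linStat_sq hS hD]
  simp

/-- A centred linear statistic that is almost surely constant has zero coefficients. -/
lemma eq_zero_of_linStat_ae_eq_const [IsProbabilityMeasure D] (hS : S.PosDef)
    (hD : D.map jointVec = multivariateGaussian μ S) {w : JointIdx p q → ℝ} {c : ℝ}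
    (h : ∀ᵐ z ∂D, linStat μ w z = c) : w = 0 := by
  have hc : c = 0 := by
    have h0 := integral_linStat hD w
    rw [integral_congr_ae h] at h0
    simpa using h0
  apply covForm_self_eq_zero hS
  rw [← integral_linStat_sq hS hD, integral_congr_ae (g := fun _ => (0 : ℝ))]
  · simp
  · filter_upwards [h] with z hz
    simp [hz, hc]

/-- Uncorrelated families of linear statistics are independent. -/
lemma indepFun_linStat [IsProbabilityMeasure D] (hS : S.PosDef)
    (hD : D.map jointVec = multivariateGaussian μ S) {ι κ : Type*} [Finite ι] [Finite κ]
    (w : ι → JointIdx p q → ℝ) (w' : κ → JointIdx p q → ℝ)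
    (h : ∀ i j, covForm S (w i) (w' j) = 0) :
    IndepFun (fun z i => linStat μ (w i) z) (fun z j => linStat μ (w' j) z) D := by
  let _ := Fintype.ofFinite ι
  let _ := Fintype.ofFinite κ
  have hcent : HasGaussianLaw (fun z : Covariates p q × ℝ => jointVec z - μ) D := by
    constructor
    have h1 : D.map (fun z : Covariates p q × ℝ => jointVec z - μ) =
        (D.map jointVec).map (fun x => x - μ) := by
      rw [Measure.map_map (by fun_prop) continuous_jointVec.measurable]
      rfl
    rw [h1, hD]
    infer_instance
  let A (v : JointIdx p q → ℝ) : EuclideanSpace ℝ (JointIdx p q) →L[ℝ] ℝ :=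
    ∑ k, v k • EuclideanSpace.proj k
  have hA (v : JointIdx p q → ℝ) (z : Covariates p q × ℝ) :
      A v (jointVec z - μ) = linStat μ v z := by
    simp only [A, linStat_apply, sum_apply, smul_apply, smul_eq_mul]
    rfl
  have hlaw := hcent.map_fun ((ContinuousLinearMap.pi fun i => A (w i)).prod
    (ContinuousLinearMap.pi fun j => A (w' j)))
  refine HasGaussianLaw.indepFun_of_covariance_eval (X := fun i z => linStat μ (w i) z)
    (Y := fun j z => linStat μ (w' j) z) ?_ fun i j => ?_
  · have hfun : (fun z => (fun i => linStat μ (w i) z, fun j => linStat μ (w' j) z)) =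
        fun z => ((ContinuousLinearMap.pi fun i => A (w i)).prod
          (ContinuousLinearMap.pi fun j => A (w' j))) (jointVec z - μ) := by
      funext z
      ext i
      · exact (hA _ z).symm
      · exact (hA _ z).symm
    rw [hfun]
    exact hlaw
  · rw [← h i j]
    exact covariance_linStat hS hD _ _

/-- Linear statistics that are uncorrelated with some of the coordinates are independent of
those coordinates. -/
lemma indepFun_linStat_coord [IsProbabilityMeasure D] (hS : S.PosDef)
    (hD : D.map jointVec = multivariateGaussian μ S) {ι κ : Type*} [Finite ι] [Finite κ]
    (w : ι → JointIdx p q → ℝ) (e : κ → JointIdx p q)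
    (h : ∀ i j, covForm S (w i) (coordVec (e j)) = 0) :
    IndepFun (fun z i => linStat μ (w i) z) (fun z j => jointVec z (e j)) D := by
  have h1 := (indepFun_linStat hS hD w (fun j => coordVec (e j)) h).comp
    (φ := id) (ψ := fun (x : κ → ℝ) j => x j + μ (e j)) measurable_id (by fun_prop)
  simpa [Function.comp_def, linStat_coordVec] using h1

/-- If `N` is independent of `X` then `E[g(X) + N | X] = g(X) + E[N]`. -/
lemma condExp_add_of_indepFun {Ω 𝒳 : Type*} [MeasurableSpace Ω] [MeasurableSpace 𝒳]
    {P : Measure Ω} [IsProbabilityMeasure P] {X : Ω → 𝒳} {N : Ω → ℝ} {g : 𝒳 → ℝ}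
    (hX : Measurable X) (hN : Measurable N) (hg : Measurable g) (hind : IndepFun N X P)
    (hgi : Integrable (fun ω => g (X ω)) P) (hNi : Integrable N P) :
    P[fun ω => g (X ω) + N ω | MeasurableSpace.comap X inferInstance] =ᵐ[P]
      fun ω => g (X ω) + ∫ ω', N ω' ∂P := by
  have h1 := condExp_add hgi hNi (MeasurableSpace.comap X inferInstance)
  have h2 : P[fun ω => g (X ω) | MeasurableSpace.comap X inferInstance] =
      fun ω => g (X ω) :=
    condExp_of_stronglyMeasurable hX.comap_le
      (hg.comp (comap_measurable X)).stronglyMeasurable hgi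
  have h3 : P[N | MeasurableSpace.comap X inferInstance] =ᵐ[P] fun _ => ∫ ω', N ω' ∂P :=
    condExp_indep_eq hN.comap_le hX.comap_le (comap_measurable N).stronglyMeasurable hind
  filter_upwards [h1, h3] with ω hω1 hω3
  rw [show (fun ω => g (X ω) + N ω) = (fun ω => g (X ω)) + N from rfl, hω1, Pi.add_apply, h2, hω3]

/-- Pythagoras for a centred statistic `N` independent of `X`, also when `g(X)` is not square
integrable, in which case both sides are infinite. -/
lemma lintegral_sub_sq_of_indepFun {Ω 𝒳 : Type*} [MeasurableSpace Ω] [MeasurableSpace 𝒳]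
    {P : Measure Ω} [IsProbabilityMeasure P] {X : Ω → 𝒳} {N : Ω → ℝ} {g : 𝒳 → ℝ}
    (hX : Measurable X) (hN : Measurable N) (hg : Measurable g) (hind : IndepFun X N P)
    (hN2 : MemLp N 2 P) (hN0 : ∫ ω, N ω ∂P = 0) :
    ∫⁻ ω, ENNReal.ofReal ((g (X ω) - N ω) ^ 2) ∂P =
      ∫⁻ ω, ENNReal.ofReal (g (X ω) ^ 2) ∂P + ENNReal.ofReal (∫ ω, N ω ^ 2 ∂P) := by
  have hmap := (indepFun_iff_map_prod_eq_prod_map_map hX.aemeasurable hN.aemeasurable).1 hind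
  have hprob : IsProbabilityMeasure (P.map N) := Measure.isProbabilityMeasure_map hN.aemeasurable
  have hprob' : IsProbabilityMeasure (P.map X) := Measure.isProbabilityMeasure_map hX.aemeasurable
  have hinner (x : 𝒳) : ∫⁻ y, ENNReal.ofReal ((g x - y) ^ 2) ∂(P.map N) =
      ENNReal.ofReal (g x ^ 2) + ENNReal.ofReal (∫ ω, N ω ^ 2 ∂P) := by
    rw [lintegral_map (by fun_prop) hN]
    have hint : Integrable (fun ω => (g x - N ω) ^ 2) P :=
      ((memLp_const (g x)).sub hN2).integrable_sq
    have h1 : Integrable N P := hN2.integrable (by norm_num)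
    rw [← ofReal_integral_eq_lintegral_ofReal hint (Eventually.of_forall fun ω => sq_nonneg _),
      ← ENNReal.ofReal_add (sq_nonneg _) (integral_nonneg fun ω => sq_nonneg _)]
    congr 1
    have hsq : (fun ω => (g x - N ω) ^ 2) =
        fun ω => g x ^ 2 + (-(2 * g x)) * N ω + N ω ^ 2 := by
      ext ω; ring
    have h3 : Integrable (fun ω => g x ^ 2 + (-(2 * g x)) * N ω) P :=
      (integrable_const _).add (h1.const_mul _)
    rw [hsq, integral_add h3 hN2.integrable_sq,
      integral_add (integrable_const _) (h1.const_mul _), integral_const_mul, hN0]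
    simp
  calc ∫⁻ ω, ENNReal.ofReal ((g (X ω) - N ω) ^ 2) ∂P
      = ∫⁻ w, ENNReal.ofReal ((g w.1 - w.2) ^ 2) ∂(P.map fun ω => (X ω, N ω)) := by
        rw [lintegral_map (by fun_prop) (hX.prodMk hN)]
    _ = ∫⁻ x, ENNReal.ofReal (g x ^ 2) + ENNReal.ofReal (∫ ω, N ω ^ 2 ∂P) ∂(P.map X) := by
        rw [hmap, lintegral_prod _ (by fun_prop)]
        simp_rw [hinner]
    _ = _ := by
        rw [lintegral_add_right _ measurable_const, lintegral_const, measure_univ, mul_one,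
          lintegral_map (by fun_prop) hX]

end

/-! ### Regression on `Φ` and on `(Φ, Y)` -/

noncomputable section

variable {p q : ℕ} (S : Matrix (JointIdx p q) (JointIdx p q) ℝ)

lemma covForm_coordVec (k l : JointIdx p q) : covForm S (coordVec k) (coordVec l) = S k l := by
  simp [covForm, coordVec]

lemma covForm_eq_sum_coordVec (w w' : JointIdx p q → ℝ) :
    covForm S w w' = ∑ k, w' k * covForm S w (coordVec k) := by
  have h : w' = ∑ k, w' k • coordVec k := by
    ext l
    simp [Finset.sum_apply, Pi.single_apply]
  conv_lhs => rw [h]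
  rw [map_sum]
  simp only [map_smul, smul_eq_mul]

lemma covForm_eq_zero_of_forall_coordVec {w w' : JointIdx p q → ℝ}
    (h : ∀ k, w' k = 0 ∨ covForm S w (coordVec k) = 0) : covForm S w w' = 0 := by
  rw [covForm_eq_sum_coordVec]
  exact Finset.sum_eq_zero fun k _ => mul_eq_zero.2 (h k)

/-- The residual of the coordinate `k` after linear regression on the block `Φ`. -/
def residVec (k : JointIdx p q) : JointIdx p q → ℝ :=
  coordVec k - ∑ i, (S.submatrix id idxΦ * (S.submatrix idxΦ idxΦ)⁻¹) k i • coordVec (idxΦ i)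

lemma covForm_residVec_coordVec (k l : JointIdx p q) :
    covForm S (residVec S k) (coordVec l) = schurΦ S id id k l := by
  simp only [residVec, map_sub, map_sum, map_smul, LinearMap.sub_apply, LinearMap.sum_apply,
    LinearMap.smul_apply, covForm_coordVec, smul_eq_mul]
  exact congrArg (S k l - ·) (Matrix.mul_apply (M := S.submatrix id idxΦ * _)
    (N := S.submatrix idxΦ id)).symm

lemma idxΦ_injective : Function.Injective (idxΦ : Fin p → JointIdx p q) := Sum.inl_injective

lemma residVec_idxΨ (k : JointIdx p q) (j : Fin q) :
    residVec S k (idxΨ j) = coordVec k (idxΨ j) := by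
  simp [residVec, Finset.sum_apply, idxΨ, idxΦ]

lemma residVec_idxY (k : JointIdx p q) : residVec S k (idxY ()) = coordVec k (idxY ()) := by
  simp [residVec, Finset.sum_apply, idxY, idxΦ]

lemma coordVec_idxY_idxΨ (j : Fin q) : coordVec (idxY () : JointIdx p q) (idxΨ j) = 0 := by
  simp [idxΨ, idxY]

lemma coordVec_idxΨ_idxY (j : Fin q) : coordVec (idxΨ j : JointIdx p q) (idxY ()) = 0 := by
  simp [idxΨ, idxY]

lemma coordVec_idxΨ (j j' : Fin q) :
    coordVec (idxΨ j : JointIdx p q) (idxΨ j') = if j = j' then 1 else 0 := by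
  by_cases h : j = j'
  · simp [h]
  · have h' : (idxΨ j' : JointIdx p q) ≠ idxΨ j := by simpa [idxΨ, eq_comm] using h
    simp [h, Pi.single_eq_of_ne h']

/-- The residual `ε` of `Y` after regression on `Φ`. -/
def epsVec : JointIdx p q → ℝ := residVec S (idxY ())

/-- The residual of `Ψⱼ` after regression on `Φ`. -/
def psiVec (j : Fin q) : JointIdx p q → ℝ := residVec S (idxΨ j)

/-- The regression `γ` of `Y` on `Φ`. -/
def gamVec : JointIdx p q → ℝ := coordVec (idxY ()) - epsVec S

/-- The coefficients of the regression of `ε` on the residuals of `Ψ`. -/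
def delCoef : Fin q → ℝ :=
  (schurΦ S idxΨ idxΨ)⁻¹.mulVec fun j => schurΦ S idxΨ idxY j ()

/-- The regression `δ` of `ε` on the residuals of `Ψ`. Thus `γ + δ` is the regression of `Y` on
all of `X`. -/
def delVec : JointIdx p q → ℝ := ∑ j, delCoef S j • psiVec S j

/-- The residual of `Ψⱼ` after regression on `(Φ, Y)`. -/
def grpVec (j : Fin q) : JointIdx p q → ℝ :=
  psiVec S j - (covForm S (psiVec S j) (epsVec S) / covForm S (epsVec S) (epsVec S)) • epsVec S

lemma epsVec_idxY : epsVec S (idxY ()) = 1 := by simp [epsVec, residVec_idxY]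

lemma epsVec_idxΨ (j : Fin q) : epsVec S (idxΨ j) = 0 := by
  rw [epsVec, residVec_idxΨ, coordVec_idxY_idxΨ]

lemma epsVec_ne_zero : epsVec S ≠ 0 := fun h => by simpa [h] using epsVec_idxY S

lemma gamVec_idxΨ (j : Fin q) : gamVec S (idxΨ j) = 0 := by
  rw [gamVec, Pi.sub_apply, epsVec_idxΨ, coordVec_idxY_idxΨ, sub_zero]

lemma gamVec_idxY : gamVec S (idxY ()) = 0 := by simp [gamVec, epsVec_idxY]

lemma psiVec_idxΨ (j j' : Fin q) : psiVec S j (idxΨ j') = if j = j' then 1 else 0 := by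
  rw [psiVec, residVec_idxΨ, coordVec_idxΨ]

lemma psiVec_idxY (j : Fin q) : psiVec S j (idxY ()) = 0 := by
  rw [psiVec, residVec_idxY, coordVec_idxΨ_idxY]

lemma grpVec_idxΨ (j j' : Fin q) : grpVec S j (idxΨ j') = if j = j' then 1 else 0 := by
  simp [grpVec, psiVec_idxΨ, epsVec_idxΨ]

lemma delVec_idxY : delVec S (idxY ()) = 0 := by
  simp [delVec, Finset.sum_apply, psiVec_idxY]

lemma sum_grpVec_idxΨ (c : Fin q → ℝ) (j : Fin q) : (∑ i, c i • grpVec S i) (idxΨ j) = c j := by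
  simp [Finset.sum_apply, grpVec_idxΨ]

variable {S}

lemma covForm_residVec_idxΦ (hS : S.PosDef) (k : JointIdx p q) (i : Fin p) :
    covForm S (residVec S k) (coordVec (idxΦ i)) = 0 := by
  have hP : (S.submatrix idxΦ (idxΦ : Fin p → JointIdx p q)).PosDef :=
    hS.submatrix idxΦ_injective
  have hdet := (Matrix.isUnit_iff_isUnit_det _).1 hP.isUnit
  rw [covForm_residVec_coordVec]
  have h : S.submatrix id idxΦ * (S.submatrix idxΦ (idxΦ : Fin p → JointIdx p q))⁻¹ *
      S.submatrix idxΦ idxΦ = S.submatrix id idxΦ := by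
    rw [Matrix.mul_assoc, Matrix.nonsing_inv_mul _ hdet, Matrix.mul_one]
  have h' := congrFun (congrFun h k) i
  simp only [schurΦ, Matrix.sub_apply, sub_eq_zero]
  exact h'.symm

lemma covForm_residVec_of_idxΦ (hS : S.PosDef) (k : JointIdx p q) {w : JointIdx p q → ℝ}
    (hΨ : ∀ j, w (idxΨ j) = 0) (hY : w (idxY ()) = 0) : covForm S (residVec S k) w = 0 := by
  refine covForm_eq_zero_of_forall_coordVec S ?_
  rintro (i | j | u)
  · exact Or.inr (covForm_residVec_idxΦ hS k i)
  · exact Or.inl (hΨ j)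
  · exact Or.inl hY

lemma covForm_residVec (hS : S.PosDef) (k l : JointIdx p q) :
    covForm S (residVec S k) (residVec S l) = schurΦ S id id k l := by
  conv_lhs => rw [residVec.eq_1 S l]
  rw [map_sub, covForm_residVec_coordVec, map_sum]
  simp [covForm_residVec_idxΦ hS]

lemma covForm_residVec_gamVec (hS : S.PosDef) (k : JointIdx p q) :
    covForm S (residVec S k) (gamVec S) = 0 :=
  covForm_residVec_of_idxΦ hS k (gamVec_idxΨ S) (gamVec_idxY S)

lemma covForm_epsVec_gamVec (hS : S.PosDef) : covForm S (epsVec S) (gamVec S) = 0 :=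
  covForm_residVec_gamVec hS _

lemma covForm_epsVec_self_pos (hS : S.PosDef) : 0 < covForm S (epsVec S) (epsVec S) :=
  covForm_self_pos hS (epsVec_ne_zero S)

lemma covForm_psiVec (hS : S.PosDef) (j j' : Fin q) :
    covForm S (psiVec S j) (psiVec S j') = schurΦ S idxΨ idxΨ j j' := covForm_residVec hS _ _

lemma covForm_psiVec_epsVec (hS : S.PosDef) (j : Fin q) :
    covForm S (psiVec S j) (epsVec S) = schurΦ S idxΨ idxY j () := covForm_residVec hS _ _

lemma posDef_schurΦ_idxΨ (hS : S.PosDef) :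
    (schurΦ S idxΨ (idxΨ : Fin q → JointIdx p q)).PosDef := by
  refine Matrix.PosDef.of_dotProduct_mulVec_pos ?_ fun {x} hx => ?_
  · ext i j
    simp only [Matrix.conjTranspose_apply, star_trivial, ← covForm_psiVec hS]
    exact covForm_symm hS _ _
  · have hv : (∑ j, x j • psiVec S j) ≠ 0 := by
      intro h0
      apply hx
      ext j
      have := congrFun h0 (idxΨ j)
      simpa [Finset.sum_apply, psiVec_idxΨ] using this
    have hT : (schurΦ S idxΨ idxΨ).mulVec x =
        fun i => covForm S (∑ j, x j • psiVec S j) (psiVec S i) := by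
      ext i
      rw [covForm_symm hS]
      simp [Matrix.mulVec, dotProduct, covForm_psiVec hS, mul_comm]
    have hpos := covForm_self_pos hS hv
    rw [hT]
    rw [map_sum] at hpos
    simpa only [dotProduct, map_smul, smul_eq_mul, star_trivial] using hpos

/-- The defining property of `δ`: the difference `ε - δ` is uncorrelated with the residuals of
`Ψ`. -/
lemma covForm_psiVec_delVec (hS : S.PosDef) (j : Fin q) :
    covForm S (psiVec S j) (delVec S) = covForm S (psiVec S j) (epsVec S) := by
  have hdet := (Matrix.isUnit_iff_isUnit_det _).1 (posDef_schurΦ_idxΨ hS).isUnit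
  have h : (schurΦ S idxΨ idxΨ).mulVec (delCoef S) = fun j => schurΦ S idxΨ idxY j () := by
    rw [delCoef, Matrix.mulVec_mulVec, Matrix.mul_nonsing_inv _ hdet, Matrix.one_mulVec]
  rw [covForm_psiVec_epsVec hS, ← congrFun h j]
  simp [delVec, map_sum, covForm_psiVec hS, Matrix.mulVec, dotProduct, mul_comm]

lemma covForm_delVec_epsVec (hS : S.PosDef) :
    covForm S (delVec S) (epsVec S) = covForm S (delVec S) (delVec S) := by
  have h (w : JointIdx p q → ℝ) :
      covForm S (delVec S) w = ∑ j, delCoef S j * covForm S (psiVec S j) w := by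
    simp [delVec]
  rw [h, h]
  simp_rw [covForm_psiVec_delVec hS]

/-- `M` is the fraction of the variance of `Y` left by `Φ` that `Ψ` explains. -/
lemma ratioM_eq (hS : S.PosDef) :
    ratioM S = covForm S (delVec S) (delVec S) / covForm S (epsVec S) (epsVec S) := by
  have h1 : schurΦ S idxY idxY () () = covForm S (epsVec S) (epsVec S) :=
    (covForm_residVec hS _ _).symm
  have h2 (j : Fin q) : schurΦ S idxY idxΨ () j = schurΦ S idxΨ idxY j () := by
    rw [← covForm_psiVec_epsVec hS, covForm_symm hS]
    exact (covForm_residVec hS _ _).symm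
  have h3 : (schurΦ S idxY (idxY : Unit → JointIdx p q))⁻¹ () () =
      (covForm S (epsVec S) (epsVec S))⁻¹ := by
    rw [Matrix.inv_def, Matrix.adjugate_subsingleton, Matrix.det_unique, ← h1]
    simp
  rw [← covForm_delVec_epsVec hS, ratioM, Matrix.mul_assoc, Matrix.mul_assoc, Matrix.mul_apply]
  simp only [Finset.univ_unique, PUnit.default_eq_unit, Finset.sum_singleton]
  rw [h3, div_eq_inv_mul, Matrix.mul_apply]
  congr 1
  simp only [delVec, map_sum, LinearMap.sum_apply, map_smul, LinearMap.smul_apply, smul_eq_mul,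
    covForm_psiVec_epsVec hS]
  refine Finset.sum_congr rfl fun j _ => ?_
  rw [h2, mul_comm]
  rfl

lemma ratioM_nonneg (hS : S.PosDef) : 0 ≤ ratioM S := by
  rw [ratioM_eq hS]
  exact div_nonneg (covForm_self_nonneg hS _) (covForm_self_nonneg hS _)

/-- The unexplained part `ε - δ` of `Y` is nondegenerate. -/
lemma ratioM_lt_one (hS : S.PosDef) : ratioM S < 1 := by
  rw [ratioM_eq hS, div_lt_one (covForm_epsVec_self_pos hS)]
  have hne : epsVec S - delVec S ≠ 0 := fun h => by
    simpa [epsVec_idxY, delVec_idxY] using congrFun h (idxY ())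
  have h := covForm_self_pos hS hne
  simp only [map_sub, LinearMap.sub_apply, covForm_symm hS (epsVec S) (delVec S),
    covForm_delVec_epsVec hS] at h
  linarith

/-- The regression of `δ` on `(Φ, Y)` is `M ε`, and its residual is the corresponding combination
of the residuals of `Ψ` given `(Φ, Y)`. -/
lemma sum_delCoef_grpVec (hS : S.PosDef) :
    ∑ j, delCoef S j • grpVec S j = delVec S - ratioM S • epsVec S := by
  have h : ratioM S = ∑ j, delCoef S j *
      (covForm S (psiVec S j) (epsVec S) / covForm S (epsVec S) (epsVec S)) := by
    rw [ratioM_eq hS, ← covForm_delVec_epsVec hS]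
    simp [delVec, Finset.sum_div, mul_div_assoc]
  rw [h, delVec, Finset.sum_smul, ← Finset.sum_sub_distrib]
  exact Finset.sum_congr rfl fun j _ => by rw [grpVec, smul_sub, smul_smul]

lemma covForm_grpVec_epsVec (hS : S.PosDef) (j : Fin q) :
    covForm S (grpVec S j) (epsVec S) = 0 := by
  simp [grpVec, div_mul_cancel₀ _ (covForm_epsVec_self_pos hS).ne']

/-- The residuals of `Ψ` given `(Φ, Y)` are uncorrelated with every combination of `(Φ, Y)`. -/
lemma covForm_grpVec_of_idxΨ (hS : S.PosDef) (j : Fin q) {w : JointIdx p q → ℝ}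
    (hw : ∀ j, w (idxΨ j) = 0) : covForm S (grpVec S j) w = 0 := by
  have hΦ {w : JointIdx p q → ℝ} (hΨ : ∀ j, w (idxΨ j) = 0) (hY : w (idxY ()) = 0) :
      covForm S (grpVec S j) w = 0 := by
    simp only [grpVec, map_sub, map_smul, LinearMap.sub_apply, LinearMap.smul_apply]
    rw [psiVec, epsVec, covForm_residVec_of_idxΦ hS _ hΨ hY,
      covForm_residVec_of_idxΦ hS _ hΨ hY, smul_zero, sub_zero]
  have h := hΦ (w := w - w (idxY ()) • epsVec S) (by simp [hw, epsVec_idxΨ])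
    (by simp [epsVec_idxY])
  simpa [covForm_grpVec_epsVec hS] using h

/-- `ε - δ`, the residual of `Y` given `X`, is uncorrelated with every combination of `X`. -/
lemma covForm_eps_sub_del_of_idxY (hS : S.PosDef) {w : JointIdx p q → ℝ}
    (hw : w (idxY ()) = 0) : covForm S (epsVec S - delVec S) w = 0 := by
  have hψ (j : Fin q) : covForm S (epsVec S - delVec S) (psiVec S j) = 0 := by
    rw [covForm_symm hS, map_sub, covForm_psiVec_delVec hS, sub_self]
  have hΦ {w : JointIdx p q → ℝ} (hΨ : ∀ j, w (idxΨ j) = 0) (hY : w (idxY ()) = 0) :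
      covForm S (epsVec S - delVec S) w = 0 := by
    simp only [delVec, map_sub, map_sum, map_smul, LinearMap.sub_apply, LinearMap.sum_apply,
      LinearMap.smul_apply]
    rw [epsVec, covForm_residVec_of_idxΦ hS _ hΨ hY]
    simp [psiVec, covForm_residVec_of_idxΦ hS _ hΨ hY]
  have h := hΦ (w := w - ∑ j, w (idxΨ j) • psiVec S j)
    (fun j => by simp [Finset.sum_apply, psiVec_idxΨ])
    (by simp [Finset.sum_apply, psiVec_idxY, hw])
  simp only [map_sub (covForm S (epsVec S - delVec S)), map_sum, map_smul, hψ, smul_zero,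
    Finset.sum_const_zero, sub_zero] at h
  exact h

/-- If `E[Y | Φ]` is constant then `Φ` and `Y` are uncorrelated. -/
lemma submatrix_idxΦ_idxY_eq_zero (hS : S.PosDef) (h : gamVec S = 0) :
    S.submatrix idxΦ (idxY : Unit → JointIdx p q) = 0 := by
  ext i u
  have he : epsVec S = coordVec (idxY ()) := (sub_eq_zero.1 h).symm
  have h1 := covForm_residVec_idxΦ hS (idxY ()) i
  rw [← epsVec, he, covForm_symm hS, covForm_coordVec] at h1
  exact h1

lemma delCoef_eq_zero (hΦ : S.submatrix idxΦ (idxY : Unit → JointIdx p q) = 0)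
    (hΨ : S.submatrix idxΨ (idxY : Unit → JointIdx p q) = 0) : delCoef S = 0 := by
  have : schurΦ S idxΨ (idxY : Unit → JointIdx p q) = 0 := by simp [schurΦ, hΦ, hΨ]
  rw [delCoef, this]
  exact Matrix.mulVec_zero _

end

/-! ### Conditional expectations and linear grouping functions -/

noncomputable section

variable {p q : ℕ} {μ : EuclideanSpace ℝ (JointIdx p q)}
  {S : Matrix (JointIdx p q) (JointIdx p q) ℝ} {D : Measure (Covariates p q × ℝ)}

lemma linStat_eq_inner (w : JointIdx p q → ℝ) (z : Covariates p q × ℝ) :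
    linStat μ w z = inner ℝ (WithLp.toLp 2 fun i => w (idxΦ i)) z.1.1 +
      inner ℝ (WithLp.toLp 2 fun j => w (idxΨ j)) z.1.2 + w (idxY ()) * z.2 -
        ∑ k, w k * μ k := by
  simp only [linStat_apply, mul_sub, Finset.sum_sub_distrib, Fintype.sum_sum_type]
  simp [jointVec, PiLp.inner_apply, idxΦ, idxΨ, idxY, mul_comm, add_assoc]

/-- A statistic without `Y`-coefficient depends on the covariates only. -/
lemma linStat_eq_of_idxY {w : JointIdx p q → ℝ} (hw : w (idxY ()) = 0)
    (z : Covariates p q × ℝ) (y : ℝ) : linStat μ w (z.1, y) = linStat μ w z := by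
  simp [linStat_eq_inner, hw]

/-- A statistic without `Ψ`-coefficients depends on `(Φ, Y)` only. -/
lemma linStat_eq_of_idxΨ {w : JointIdx p q → ℝ} (hw : ∀ j, w (idxΨ j) = 0)
    (z : Covariates p q × ℝ) (ψ : EuclideanSpace ℝ (Fin q)) :
    linStat μ w ((z.1.1, ψ), z.2) = linStat μ w z := by
  have h0 : (WithLp.toLp 2 fun _ : Fin q => (0 : ℝ)) = 0 := rfl
  simp [linStat_eq_inner, hw, h0]

section Independence

variable [IsProbabilityMeasure D]

lemma indepFun_linStat_phi_y (hS : S.PosDef) (hD : D.map jointVec = multivariateGaussian μ S)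
    {w : JointIdx p q → ℝ} (hΦ : ∀ i, covForm S w (coordVec (idxΦ i)) = 0)
    (hY : covForm S w (coordVec (idxY ())) = 0) :
    IndepFun (linStat μ w) (fun z : Covariates p q × ℝ => (z.1.1, z.2)) D :=
  (indepFun_linStat_coord hS hD (fun _ : Unit => w) (Sum.elim idxΦ idxY)
    (by rintro - (i | u); exacts [hΦ i, hY])).comp
      (φ := fun x : Unit → ℝ => x ()) (ψ := fun x : Fin p ⊕ Unit → ℝ =>
        (WithLp.toLp 2 fun i => x (Sum.inl i), x (Sum.inr ())))
      (by fun_prop) (by fun_prop)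

lemma indepFun_linStat_covariates (hS : S.PosDef)
    (hD : D.map jointVec = multivariateGaussian μ S)
    {w : JointIdx p q → ℝ} (h : ∀ w', w' (idxY ()) = 0 → covForm S w w' = 0) :
    IndepFun (linStat μ w) (fun z : Covariates p q × ℝ => z.1) D :=
  (indepFun_linStat_coord hS hD (fun _ : Unit => w) (Sum.elim idxΦ idxΨ)
    (by rintro - (i | j) <;> exact h _ (by simp [idxΦ, idxΨ, idxY]))).comp
      (φ := fun x : Unit → ℝ => x ()) (ψ := fun x : Fin p ⊕ Fin q → ℝ =>
        (WithLp.toLp 2 fun i => x (Sum.inl i), WithLp.toLp 2 fun j => x (Sum.inr j)))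
      (by fun_prop) (by fun_prop)

lemma indepFun_linStat_phi (hS : S.PosDef) (hD : D.map jointVec = multivariateGaussian μ S)
    {w : JointIdx p q → ℝ} (hΦ : ∀ i, covForm S w (coordVec (idxΦ i)) = 0) :
    IndepFun (linStat μ w) (fun z : Covariates p q × ℝ => z.1.1) D :=
  (indepFun_linStat_coord hS hD (fun _ : Unit => w) idxΦ (fun _ i => hΦ i)).comp
      (φ := fun x : Unit → ℝ => x ()) (ψ := fun x : Fin p → ℝ => WithLp.toLp 2 fun i => x i)
      (by fun_prop) (by fun_prop)

/-- The linear grouping functions are the affine functions of the residuals of `Ψ` given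
`(Φ, Y)`: an affine function of `(Φ, Y)` with constant conditional expectation is constant. -/
lemma mem_linearH2_iff (hS : S.PosDef) (hD : D.map jointVec = multivariateGaussian μ S)
    (h : Covariates p q × ℝ → ℝ) :
    h ∈ linearH2 D ↔ ∃ (c : Fin q → ℝ) (c₀ : ℝ),
      h = fun z => linStat μ (∑ j, c j • grpVec S j) z + c₀ := by
  have hind (c : Fin q → ℝ) : IndepFun (linStat μ (∑ j, c j • grpVec S j))
      (fun z : Covariates p q × ℝ => (z.1.1, z.2)) D := by
    refine indepFun_linStat_phi_y hS hD (fun i => ?_) ?_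
    · simp only [map_sum, map_smul, LinearMap.sum_apply, LinearMap.smul_apply]
      exact Finset.sum_eq_zero fun j _ => by
        rw [covForm_grpVec_of_idxΨ hS j (by simp [idxΦ, idxΨ]), smul_zero]
    · simp only [map_sum, map_smul, LinearMap.sum_apply, LinearMap.smul_apply]
      exact Finset.sum_eq_zero fun j _ => by
        rw [covForm_grpVec_of_idxΨ hS j coordVec_idxY_idxΨ, smul_zero]
  constructor
  · rintro ⟨⟨-, -, C, hC⟩, cΦ, cΨ, cy, cb, hform⟩
    set w : JointIdx p q → ℝ := Sum.elim (fun i => cΦ i) (Sum.elim (fun j => cΨ j) fun _ => cy)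
      with hw
    set r : JointIdx p q → ℝ := ∑ j, cΨ j • grpVec S j with hr
    have hw0 (j : Fin q) : (w - r) (idxΨ j) = 0 := by
      rw [Pi.sub_apply, hr, sum_grpVec_idxΨ]
      simp [hw, idxΨ]
    set c₀ : ℝ := cb + ∑ k, w k * μ k with hc₀
    have hform' (z : Covariates p q × ℝ) :
        h z = (linStat μ (w - r) ((z.1.1, 0), z.2) + c₀) + linStat μ r z := by
      rw [linStat_eq_of_idxΨ hw0, map_sub, Pi.sub_apply, linStat_eq_inner w, hform z, hc₀]
      simp only [hw, idxΦ, idxΨ, idxY, Sum.elim_inl, Sum.elim_inr]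
      ring
    have hm := measurable_linStat μ (w - r)
    have hcond := condExp_add_of_indepFun
      (X := fun z : Covariates p q × ℝ => (z.1.1, z.2)) (N := linStat μ r)
      (g := fun x => linStat μ (w - r) ((x.1, 0), x.2) + c₀) (by fun_prop)
      (measurable_linStat μ r) (by fun_prop) (hind _)
      (by
        simp only [linStat_eq_of_idxΨ hw0]
        exact (integrable_linStat hD _).add (integrable_const _))
      (integrable_linStat hD r)
    have hzero : w - r = 0 := by
      refine eq_zero_of_linStat_ae_eq_const hS hD (c := C - c₀) ?_
      rw [← funext hform'] at hcond
      filter_upwards [hcond, hC] with z hz1 hz2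
      rw [hz2, integral_linStat hD, linStat_eq_of_idxΨ hw0] at hz1
      linarith
    refine ⟨fun j => cΨ j, c₀, funext fun z => ?_⟩
    rw [hform' z, hzero]
    simp [hr, add_comm]
  · rintro ⟨c, c₀, rfl⟩
    set r : JointIdx p q → ℝ := ∑ j, c j • grpVec S j with hr
    refine ⟨⟨(continuous_linStat μ r).add continuous_const,
      (integrable_linStat hD r).add (integrable_const _), c₀, ?_⟩,
      WithLp.toLp 2 fun i => r (idxΦ i), WithLp.toLp 2 fun j => r (idxΨ j), r (idxY ()),
      c₀ - ∑ k, r k * μ k, fun z => ?_⟩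
    · have hcond := condExp_add_of_indepFun
        (X := fun z : Covariates p q × ℝ => (z.1.1, z.2)) (N := linStat μ r)
        (g := fun _ => c₀) (by fun_prop)
        (measurable_linStat μ r) (by fun_prop) (hind _) (integrable_const _)
        (integrable_linStat hD r)
      simpa only [integral_linStat hD, add_zero, add_comm c₀, zero_add] using hcond
    · simp only [linStat_eq_inner]
      ring

/-- `E[Y | Φ] = E[Y] + γ`. -/
lemma condExp_y_phi (hS : S.PosDef) (hD : D.map jointVec = multivariateGaussian μ S) :
    D[fun z : Covariates p q × ℝ => z.2 |
      MeasurableSpace.comap (fun z : Covariates p q × ℝ => z.1.1) inferInstance] =ᵐ[D]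
      fun z => μ (idxY ()) + linStat μ (gamVec S) z := by
  have hg (z : Covariates p q × ℝ) :
      linStat μ (gamVec S) ((z.1.1, 0), 0) = linStat μ (gamVec S) z := by
    rw [linStat_eq_of_idxY (gamVec_idxY S) ((z.1.1, 0), z.2) 0,
      linStat_eq_of_idxΨ (gamVec_idxΨ S)]
  have hm := measurable_linStat μ (gamVec S)
  have hcond := condExp_add_of_indepFun
    (X := fun z : Covariates p q × ℝ => z.1.1) (N := linStat μ (epsVec S))
    (g := fun x => μ (idxY ()) + linStat μ (gamVec S) ((x, 0), 0)) (by fun_prop)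
    (measurable_linStat μ _) (by fun_prop)
    (indepFun_linStat_phi hS hD fun i => covForm_residVec_idxΦ hS _ i)
    (by
      simp only [hg]
      exact (integrable_const _).add (integrable_linStat hD _))
    (integrable_linStat hD _)
  simp only [hg, integral_linStat hD, add_zero] at hcond
  convert hcond using 2
  funext z
  have h1 := linStat_coordVec_idxY μ z
  simp only [gamVec, map_sub, Pi.sub_apply, h1]
  ring

/-- `E[Y | X] = E[Y] + γ + δ`. -/
lemma condExp_y_covariates (hS : S.PosDef)
    (hD : D.map jointVec = multivariateGaussian μ S) :
    D[fun z : Covariates p q × ℝ => z.2 |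
      MeasurableSpace.comap (fun z : Covariates p q × ℝ => z.1) inferInstance] =ᵐ[D]
      fun z => μ (idxY ()) + linStat μ (gamVec S + delVec S) z := by
  have hw : (gamVec S + delVec S) (idxY ()) = 0 := by simp [gamVec_idxY, delVec_idxY]
  have hg (z : Covariates p q × ℝ) := linStat_eq_of_idxY (μ := μ) hw z 0
  have hm := measurable_linStat μ (gamVec S + delVec S)
  have hcond := condExp_add_of_indepFun
    (X := fun z : Covariates p q × ℝ => z.1) (N := linStat μ (epsVec S - delVec S))
    (g := fun x => μ (idxY ()) + linStat μ (gamVec S + delVec S) (x, 0)) (by fun_prop)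
    (measurable_linStat μ _) (by fun_prop)
    (indepFun_linStat_covariates hS hD fun w' hw' => covForm_eps_sub_del_of_idxY hS hw')
    (by
      simp only [hg]
      exact (integrable_const _).add (integrable_linStat hD _))
    (integrable_linStat hD _)
  simp only [hg, integral_linStat hD, add_zero] at hcond
  convert hcond using 2
  funext z
  have h1 := linStat_coordVec_idxY μ z
  simp only [gamVec, map_sub, map_add, Pi.sub_apply, Pi.add_apply, h1]
  ring

end Independence

end

/-! ### One iteration on a Gaussian model -/

noncomputable section

variable {p q : ℕ} {μ : EuclideanSpace ℝ (JointIdx p q)}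
  {S : Matrix (JointIdx p q) (JointIdx p q) ℝ} {D : Measure (Covariates p q × ℝ)}
  [IsProbabilityMeasure D]

/-- On almost every level set of a Gaussian model `f(X) = m + F`, the statistic `F` takes its
prescribed value, and the statistics that are uncorrelated with `F` keep their law. -/
lemma levelSetLaw_map_linStat (hS : S.PosDef) (hD : D.map jointVec = multivariateGaussian μ S)
    {f : Covariates p q → ℝ} {m : ℝ} {F : JointIdx p q → ℝ}
    (hf : ∀ᵐ z ∂D, f z.1 = m + linStat μ F z) {κ : Type*} [Finite κ]
    (w : κ → JointIdx p q → ℝ) (hw : ∀ i, covForm S (w i) F = 0) :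
    ∀ᵐ v ∂(D.map fun z => f z.1),
      (levelSetLaw D f v).map (fun z i => linStat μ (w i) z) =
        D.map (fun z i => linStat μ (w i) z) ∧
      ∀ᵐ z ∂(levelSetLaw D f v), linStat μ F z = v - m := by
  have hmF := measurable_linStat μ F
  have hX : Measurable fun z => m + linStat μ F z := by fun_prop
  have hT : Measurable fun z i => linStat μ (w i) z :=
    measurable_pi_lambda _ fun i => measurable_linStat μ (w i)
  have hlevel (v : ℝ) : levelSetLaw D f v =
      condDistrib (fun z => z) (fun z => m + linStat μ F z) D v := by
    rw [levelSetLaw, condDistrib_congr_right hf]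
  rw [Measure.map_congr hf]
  have hind : IndepFun (fun z => m + linStat μ F z) (fun z i => linStat μ (w i) z) D :=
    (indepFun_linStat hS hD w (fun _ : Unit => F) (fun i _ => hw i)).symm.comp
      (φ := fun x : Unit → ℝ => m + x ()) (ψ := id) (by fun_prop) measurable_id
  have h1 : condDistrib (fun z i => linStat μ (w i) z) (fun z => m + linStat μ F z) D
      =ᵐ[D.map fun z => m + linStat μ F z]
        Kernel.const ℝ (D.map fun z i => linStat μ (w i) z) := by
    have := Measure.isProbabilityMeasure_map (μ := D) hT.aemeasurable
    refine condDistrib_ae_eq_of_measure_eq_compProd _ hT.aemeasurable ?_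
    rw [Measure.compProd_const]
    exact (indepFun_iff_map_prod_eq_prod_map_map hX.aemeasurable hT.aemeasurable).1 hind
  have h2 := condDistrib_comp (mβ := inferInstance) (μ := D) (fun z => m + linStat μ F z)
    (Y := fun z => z) aemeasurable_id hT
  have h3 := condDistrib_comp (mβ := inferInstance) (μ := D) (fun z => m + linStat μ F z)
    (Y := fun z => z) aemeasurable_id hX
  have h4 := condDistrib_self (μ := D) (fun z => m + linStat μ F z)
  filter_upwards [h1, h2, h3, h4] with v hv1 hv2 hv3 hv4
  rw [hlevel]
  constructor
  · rw [← Kernel.map_apply _ hT, ← hv2]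
    exact hv1
  · have hdirac : (condDistrib (fun z => z) (fun z => m + linStat μ F z) D v).map
        (fun z => m + linStat μ F z) = Measure.dirac v := by
      rw [← Kernel.map_apply _ hX, ← hv3]
      exact hv4
    have hae : ∀ᵐ y ∂((condDistrib (fun z => z) (fun z => m + linStat μ F z) D v).map
        (fun z => m + linStat μ F z)), y = v := by
      rw [hdirac, ae_dirac_eq]
      rfl
    filter_upwards [ae_of_ae_map hX.aemeasurable hae] with z hz
    linarith

/-- The part of the grouping residual `Rⱼ` that is uncorrelated with the statistic `F`. For `F = 0`
the coefficient is a division by zero, and the result is `Rⱼ`, as it should be. -/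
def grpResid (S : Matrix (JointIdx p q) (JointIdx p q) ℝ) (F : JointIdx p q → ℝ) (j : Fin q) :
    JointIdx p q → ℝ :=
  grpVec S j - (covForm S (grpVec S j) F / covForm S F F) • F

omit [IsProbabilityMeasure D]

lemma covForm_grpResid (hS : S.PosDef) (F : JointIdx p q → ℝ) (j : Fin q) :
    covForm S (grpResid S F j) F = 0 := by
  simp only [grpResid, map_sub, map_smul, LinearMap.sub_apply, LinearMap.smul_apply, smul_eq_mul]
  rcases eq_or_ne F 0 with rfl | hF
  · simp
  · rw [div_mul_cancel₀ _ (covForm_self_pos hS hF).ne', sub_self]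

lemma sum_grpResid (F : JointIdx p q → ℝ) (a : Fin q → ℝ) :
    ∑ j, a j • grpResid S F j = ∑ j, a j • grpVec S j -
      (∑ j, a j * (covForm S (grpVec S j) F / covForm S F F)) • F := by
  rw [Finset.sum_smul, ← Finset.sum_sub_distrib]
  exact Finset.sum_congr rfl fun j _ => by rw [grpResid, smul_sub, smul_smul]

/-- Conditioning on `F = u + ∑ θⱼ Rⱼ` leaves the grouping residuals linearly independent, unless
`F` is itself a nonzero combination of them. -/
lemma eq_zero_of_sum_grpResid_eq_zero {u : JointIdx p q → ℝ} {θ : Fin q → ℝ}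
    (hu : ∀ j, u (idxΨ j) = 0) (hdeg : u = 0 → θ = 0) {a : Fin q → ℝ}
    (h : ∑ j, a j • grpResid S (u + ∑ j, θ j • grpVec S j) j = 0) : a = 0 := by
  rw [sum_grpResid, sub_eq_zero] at h
  set t : ℝ := ∑ j, a j * (covForm S (grpVec S j) (u + ∑ j, θ j • grpVec S j) /
    covForm S (u + ∑ j, θ j • grpVec S j) (u + ∑ j, θ j • grpVec S j))
  have ha : a = t • θ := by
    ext j
    have := congrFun h (idxΨ j)
    rw [sum_grpVec_idxΨ] at this
    rw [this, Pi.smul_apply, Pi.add_apply, sum_grpVec_idxΨ, hu, zero_add, Pi.smul_apply]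
  have htu : t • u = 0 := by
    have hs : ∑ j, a j • grpVec S j = t • ∑ j, θ j • grpVec S j := by
      rw [ha, Finset.smul_sum]
      exact Finset.sum_congr rfl fun j _ => by rw [Pi.smul_apply, smul_assoc]
    rw [hs, smul_add] at h
    exact right_eq_add.1 h
  rcases smul_eq_zero.1 htu with h0 | h0
  · rw [ha, h0, zero_smul]
  · rw [ha, hdeg h0, smul_zero]

variable [IsProbabilityMeasure D]

/-- The risk of every linear grouping function on almost every level set of the model
`f(X) = E[Y] + u + ∑ θⱼ Rⱼ`, where `u` is a combination of `(Φ, Y)` and `λ u` is the regression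
of `Y` on `u`: the constant risk of `Y - λ u`, plus a quadratic form in `c + λ θ`, plus the square
of an offset, affine in `c₀`. -/
lemma sqRisk_levelSetLaw (hS : S.PosDef) (hD : D.map jointVec = multivariateGaussian μ S)
    {f : Covariates p q → ℝ} {u : JointIdx p q → ℝ} {θ : Fin q → ℝ} {lam : ℝ}
    (hu : ∀ j, u (idxΨ j) = 0)
    (hlam : covForm S (coordVec (idxY ()) - lam • u) u = 0)
    (hf : ∀ᵐ z ∂D, f z.1 = μ (idxY ()) + linStat μ (u + ∑ j, θ j • grpVec S j) z) :
    ∀ᵐ v ∂(D.map fun z => f z.1), ∃ b : (Fin q → ℝ) → ℝ, b 0 = -(lam * (v - μ (idxY ()))) ∧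
      ∀ (c : Fin q → ℝ) (c₀ : ℝ),
      sqRisk (levelSetLaw D f v) (fun z => linStat μ (∑ j, c j • grpVec S j) z + c₀)
        (fun z => z.2) =
      ENNReal.ofReal (
        covForm S (∑ j, (c + lam • θ) j • grpResid S (u + ∑ j, θ j • grpVec S j) j)
            (∑ j, (c + lam • θ) j • grpResid S (u + ∑ j, θ j • grpVec S j) j) +
          covForm S (coordVec (idxY ()) - lam • u) (coordVec (idxY ()) - lam • u) +
          (b (c + lam • θ) + c₀ - μ (idxY ())) ^ 2) := by
  set F := u + ∑ j, θ j • grpVec S j with hF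
  -- `N`, the residual of `Y` given `u`, is uncorrelated with `F` and with every `W j`.
  set N := coordVec (idxY ()) - lam • u with hN
  have hNΨ (j : Fin q) : N (idxΨ j) = 0 := by
    simp [hN, hu, coordVec_idxY_idxΨ]
  have hRN (j : Fin q) : covForm S (grpVec S j) N = 0 := covForm_grpVec_of_idxΨ hS j hNΨ
  have hFN : covForm S F N = 0 := by
    simp only [hF, map_add, map_sum, map_smul, LinearMap.add_apply, LinearMap.sum_apply,
      LinearMap.smul_apply, hRN, smul_zero, Finset.sum_const_zero, add_zero]
    rw [covForm_symm hS, hlam]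
  have hWN (j : Fin q) : covForm S (grpResid S F j) N = 0 := by
    simp [grpResid, hRN, hFN]
  have hlaw := levelSetLaw_map_linStat hS hD hf
    (fun i : Option (Fin q) => i.elim N (grpResid S F)) (by
      rintro (- | j)
      · exact (covForm_symm hS _ _).trans hFN
      · exact covForm_grpResid hS F j)
  filter_upwards [hlaw] with v hv
  obtain ⟨hv1, hv2⟩ := hv
  refine ⟨fun a => ((∑ j, a j * (covForm S (grpVec S j) F / covForm S F F)) - lam) *
    (v - μ (idxY ())), by simp, fun c c₀ => ?_⟩
  set a := c + lam • θ with ha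
  set t := ∑ j, a j * (covForm S (grpVec S j) F / covForm S F F) with ht
  set W := ∑ j, a j • grpResid S F j with hW
  set c₁ := (t - lam) * (v - μ (idxY ())) + c₀ - μ (idxY ()) with hc₁
  -- On the level set `F = v - E[Y]`, hence `h - Y` is an affine function of the statistics `N`
  -- and `W j`, whose law is not changed by the conditioning.
  have hvec : ∑ j, c j • grpVec S j = (W - N) + (t - lam) • F + coordVec (idxY ()) := by
    have h1 : ∑ j, a j • grpVec S j =
        ∑ j, c j • grpVec S j + lam • ∑ j, θ j • grpVec S j := by
      rw [Finset.smul_sum, ← Finset.sum_add_distrib]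
      exact Finset.sum_congr rfl fun j _ => by
        rw [ha, Pi.add_apply, Pi.smul_apply, add_smul, smul_assoc]
    rw [hW, sum_grpResid, ← ht, h1, hN]
    simp only [hF]
    module
  have hpt (z : Covariates p q × ℝ) (hz : linStat μ F z = v - μ (idxY ())) :
      linStat μ (∑ j, c j • grpVec S j) z + c₀ - z.2 = linStat μ (W - N) z + c₁ := by
    have h1 := linStat_coordVec_idxY μ z
    rw [hvec, map_add, map_add, map_smul, Pi.add_apply, Pi.add_apply, Pi.smul_apply, hz, h1,
      hc₁, smul_eq_mul]
    ring
  set T := fun (z : Covariates p q × ℝ) (i : Option (Fin q)) =>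
    linStat μ (i.elim N (grpResid S F)) z with hTdef
  have hT : Measurable T := measurable_pi_lambda _ fun i => measurable_linStat μ _
  set G := fun t : Option (Fin q) → ℝ =>
    ENNReal.ofReal ((∑ j, a j * t (some j) - t none + c₁) ^ 2) with hG
  have hGm : Measurable G := by fun_prop
  have hGT (z : Covariates p q × ℝ) :
      G (T z) = ENNReal.ofReal ((linStat μ (W - N) z + c₁) ^ 2) := by
    simp only [hG, hTdef, Option.elim, map_sub, Pi.sub_apply, hW, linStat_sum_smul]
  have hcov : covForm S (W - N) (W - N) = covForm S W W + covForm S N N := by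
    have hWN' : covForm S W N = 0 := by
      simp only [hW, map_sum, LinearMap.sum_apply, map_smul, LinearMap.smul_apply, hWN,
        smul_zero, Finset.sum_const_zero]
    have hNW' : covForm S N W = 0 := (covForm_symm hS _ _).trans hWN'
    simp only [map_sub, LinearMap.sub_apply, hWN', hNW']
    ring
  calc sqRisk (levelSetLaw D f v) (fun z => linStat μ (∑ j, c j • grpVec S j) z + c₀)
        (fun z => z.2)
      = ∫⁻ z, G (T z) ∂(levelSetLaw D f v) := by
        rw [sqRisk]
        refine lintegral_congr_ae ?_
        filter_upwards [hv2] with z hz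
        rw [hpt z hz, hGT]
    _ = ∫⁻ z, G (T z) ∂D := by
        rw [← lintegral_map hGm hT, hv1, lintegral_map hGm hT]
    _ = _ := by
        simp_rw [hGT]
        rw [lintegral_linStat_add_const_sq hS hD, hcov]

/-- On almost every level set `f(X) = v` of the model `f(X) = E[Y] + u + ∑ θⱼ Rⱼ`, the unique
regression of the label with linear grouping functions is `E[Y] + λ u`, written with
`u = v - E[Y] - ∑ θⱼ Rⱼ` as an affine function of the grouping residuals. -/
lemma isRegression_levelSetLaw_iff (hS : S.PosDef)
    (hD : D.map jointVec = multivariateGaussian μ S)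
    {f : Covariates p q → ℝ} {u : JointIdx p q → ℝ} {θ : Fin q → ℝ} {lam : ℝ}
    (hu : ∀ j, u (idxΨ j) = 0) (hdeg : u = 0 → θ = 0)
    (hlam : covForm S (coordVec (idxY ()) - lam • u) u = 0)
    (hf : ∀ᵐ z ∂D, f z.1 = μ (idxY ()) + linStat μ (u + ∑ j, θ j • grpVec S j) z) :
    ∀ᵐ v ∂(D.map fun z => f z.1), ∀ h,
      IsRegression (levelSetLaw D f v) (linearH2 D) (fun z => z.2) h ↔
        h = fun z => linStat μ (∑ j, (-(lam • θ)) j • grpVec S j) z +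
          (μ (idxY ()) + lam * (v - μ (idxY ()))) := by
  filter_upwards [sqRisk_levelSetLaw hS hD hu hlam hf] with v hv h
  obtain ⟨b, hb0, hb⟩ := hv
  set N := coordVec (idxY ()) - lam • u with hN
  have hNN : 0 ≤ covForm S N N := covForm_self_nonneg hS N
  have hbest := hb (-(lam • θ)) (μ (idxY ()) + lam * (v - μ (idxY ())))
  rw [neg_add_cancel, hb0] at hbest
  have hmem : (fun z => linStat μ (∑ j, (-(lam • θ)) j • grpVec S j) z +
      (μ (idxY ()) + lam * (v - μ (idxY ())))) ∈ linearH2 D :=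
    (mem_linearH2_iff hS hD _).2 ⟨_, _, rfl⟩
  have hbest' : sqRisk (levelSetLaw D f v)
      (fun z => linStat μ (∑ j, (-(lam • θ)) j • grpVec S j) z +
        (μ (idxY ()) + lam * (v - μ (idxY ())))) (fun z => z.2) =
      ENNReal.ofReal (covForm S N N) := by
    rw [hbest]
    congr 1
    simp
  constructor
  · rintro ⟨hH, hmin⟩
    obtain ⟨c, c₀, rfl⟩ := (mem_linearH2_iff hS hD h).1 hH
    have hle := hmin _ hmem
    rw [hb, hbest'] at hle
    set W := ∑ j, (c + lam • θ) j • grpResid S (u + ∑ j, θ j • grpVec S j) j with hW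
    have hWW : 0 ≤ covForm S W W := covForm_self_nonneg hS W
    have hle' := (ENNReal.ofReal_le_ofReal_iff hNN).1 hle
    have hsq := sq_nonneg (b (c + lam • θ) + c₀ - μ (idxY ()))
    have hW0 : W = 0 := covForm_self_eq_zero hS (by linarith)
    have hc0 : b (c + lam • θ) + c₀ - μ (idxY ()) = 0 := by
      rw [hW0] at hle'
      refine pow_eq_zero_iff (two_ne_zero) |>.1 (le_antisymm ?_ (sq_nonneg _))
      simpa using hle'
    have hc : c + lam • θ = 0 := eq_zero_of_sum_grpResid_eq_zero hu hdeg hW0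
    rw [hc, hb0] at hc0
    rw [eq_neg_of_add_eq_zero_left hc, show c₀ = μ (idxY ()) + lam * (v - μ (idxY ())) by linarith]
  · rintro rfl
    refine ⟨hmem, fun g hg => ?_⟩
    obtain ⟨c, c₀, rfl⟩ := (mem_linearH2_iff hS hD g).1 hg
    rw [hbest', hb c c₀]
    refine ENNReal.ofReal_le_ofReal ?_
    have h1 := covForm_self_nonneg hS
      (∑ j, (c + lam • θ) j • grpResid S (u + ∑ j, θ j • grpVec S j) j)
    have h2 := sq_nonneg (b (c + lam • θ) + c₀ - μ (idxY ()))
    linarith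

/-- The squared risk of a predictor of the covariates, for the pseudolabel `m + L` with `L` a
linear statistic whose regression on the covariates is `L'`. -/
lemma sqRisk_pseudolabel (hS : S.PosDef) (hD : D.map jointVec = multivariateGaussian μ S)
    {w w' : JointIdx p q → ℝ} (hw' : w' (idxY ()) = 0)
    (hort : ∀ x, x (idxY ()) = 0 → covForm S (w - w') x = 0) (m : ℝ)
    {g : Covariates p q → ℝ} (hg : Measurable g) :
    sqRisk D (fun z => g z.1) (fun z => m + linStat μ w z) =
      ∫⁻ z, ENNReal.ofReal ((g z.1 - (m + linStat μ w' z)) ^ 2) ∂D +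
        ENNReal.ofReal (covForm S (w - w') (w - w')) := by
  have hm := measurable_linStat μ w'
  have h := lintegral_sub_sq_of_indepFun (P := D)
    (X := fun z : Covariates p q × ℝ => z.1) (N := linStat μ (w - w'))
    (g := fun x => g x - (m + linStat μ w' (x, 0))) (by fun_prop) (measurable_linStat μ _)
    (by fun_prop) (indepFun_linStat_covariates hS hD hort).symm (memLp_linStat hD _)
    (integral_linStat hD _)
  rw [integral_linStat_sq hS hD] at h
  simp only [linStat_eq_of_idxY hw'] at h
  rw [← h, sqRisk]
  congr 1 with z
  rw [map_sub, Pi.sub_apply]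
  congr 2
  ring

/-- One iteration sends the model `E[Y] + u + ∑ θⱼ Rⱼ` to `E[Y] + λ u'`, where `λ u` is the
regression of `Y` on `u` and `u'` the regression of `u` on `X`, and to nothing else. -/
lemma mcPseudolabelStep_iff (hS : S.PosDef) (hD : D.map jointVec = multivariateGaussian μ S)
    {f f' : Covariates p q → ℝ} {u u' : JointIdx p q → ℝ} {θ : Fin q → ℝ} {lam : ℝ}
    (hu : ∀ j, u (idxΨ j) = 0) (hdeg : u = 0 → θ = 0)
    (hlam : covForm S (coordVec (idxY ()) - lam • u) u = 0)
    (hu' : u' (idxY ()) = 0) (hort : ∀ x, x (idxY ()) = 0 → covForm S (u - u') x = 0)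
    (hfm : Measurable f)
    (hf : ∀ᵐ z ∂D, f z.1 = μ (idxY ()) + linStat μ (u + ∑ j, θ j • grpVec S j) z) :
    MCPseudolabelStep D (linearH2 D) (allPredictors (Covariates p q)) f f' ↔
      Measurable f' ∧ ∀ᵐ z ∂D, f' z.1 = μ (idxY ()) + linStat μ (lam • u') z := by
  set m := μ (idxY ()) with hmdef
  set best : ℝ → Covariates p q × ℝ → ℝ := fun v z =>
    linStat μ (∑ j, (-(lam • θ)) j • grpVec S j) z + (m + lam * (v - m)) with hbest
  have hreg := isRegression_levelSetLaw_iff hS hD hu hdeg hlam hf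
  rw [← hmdef] at hreg
  have hfm' : AEMeasurable (fun z : Covariates p q × ℝ => f z.1) D := by fun_prop
  have hneg : ∑ j, (-(lam • θ)) j • grpVec S j = -(lam • ∑ j, θ j • grpVec S j) := by
    rw [Finset.smul_sum, ← Finset.sum_neg_distrib]
    exact Finset.sum_congr rfl fun j _ => by
      rw [Pi.neg_apply, Pi.smul_apply, neg_smul, smul_assoc]
  have hpseudo : ∀ᵐ z ∂D, best (f z.1) z = m + linStat μ (lam • u) z := by
    filter_upwards [hf] with z hz
    simp only [hbest]
    rw [hneg]
    simp only [hz, map_add, map_neg, map_smul, Pi.add_apply, Pi.neg_apply,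
      Pi.smul_apply, smul_eq_mul]
    ring
  have hlu' : (lam • u') (idxY ()) = 0 := by simp [hu']
  have hlort (x : JointIdx p q → ℝ) (hx : x (idxY ()) = 0) :
      covForm S (lam • u - lam • u') x = 0 := by
    rw [← smul_sub, map_smul, LinearMap.smul_apply, hort x hx, smul_zero]
  have hrisk (h : ℝ → Covariates p q × ℝ → ℝ)
      (hh : ∀ᵐ z ∂D, h (f z.1) z = m + linStat μ (lam • u) z) (g : Covariates p q → ℝ)
      (hg : Measurable g) : sqRisk D (fun z => g z.1) (fun z => h (f z.1) z) =
      ∫⁻ z, ENNReal.ofReal ((g z.1 - (m + linStat μ (lam • u') z)) ^ 2) ∂D +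
        ENNReal.ofReal (covForm S (lam • u - lam • u') (lam • u - lam • u')) := by
    rw [← sqRisk_pseudolabel hS hD hlu' hlort m hg]
    refine lintegral_congr_ae ?_
    filter_upwards [hh] with z hz
    rw [hz]
  have hmu' := measurable_linStat μ (lam • u')
  constructor
  · rintro ⟨h, -, hmin, hf'm, hf'⟩
    have hf'm : Measurable f' := hf'm
    refine ⟨hf'm, ?_⟩
    -- `h` need not be measurable in `v`, so it has to agree with `best` as a function, and not
    -- just almost everywhere on the level sets.
    have hh : ∀ᵐ z ∂D, h (f z.1) z = m + linStat μ (lam • u) z := by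
      have hv : ∀ᵐ v ∂(D.map fun z => f z.1), h v = best v := by
        filter_upwards [hreg, hmin] with v hv1 hv2
        exact (hv1 _).1 hv2
      filter_upwards [ae_of_ae_map hfm' hv, hpseudo] with z hz1 hz2
      rw [hz1, hz2]
    have hle := hf' (fun x => m + linStat μ (lam • u') (x, 0))
      (show Measurable _ by fun_prop)
    rw [hrisk h hh _ hf'm,
      hrisk h hh (fun x => m + linStat μ (lam • u') (x, 0)) (by fun_prop)] at hle
    simp only [linStat_eq_of_idxY hlu', sub_self, ne_eq, OfNat.ofNat_ne_zero, not_false_eq_true,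
      zero_pow, ENNReal.ofReal_zero, lintegral_zero, zero_add] at hle
    have h0 : ∫⁻ z, ENNReal.ofReal ((f' z.1 - (m + linStat μ (lam • u') z)) ^ 2) ∂D = 0 := by
      by_contra hne
      rw [add_comm] at hle
      exact absurd hle (not_le.2 (ENNReal.lt_add_right ENNReal.ofReal_ne_top hne))
    rw [lintegral_eq_zero_iff (by fun_prop)] at h0
    filter_upwards [h0] with z hz
    have hz' := ENNReal.ofReal_eq_zero.1 hz
    have := pow_eq_zero_iff (two_ne_zero) |>.1 (le_antisymm hz' (sq_nonneg _))
    linarith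
  · rintro ⟨hf'm, hf'⟩
    refine ⟨best, fun v => (mem_linearH2_iff hS hD _).2 ⟨_, _, rfl⟩, ?_, hf'm, fun g hg => ?_⟩
    · filter_upwards [hreg] with v hv
      exact (hv _).2 rfl
    · rw [hrisk best hpseudo _ hf'm, hrisk best hpseudo g hg]
      have h0 : ∫⁻ z, ENNReal.ofReal ((f' z.1 - (m + linStat μ (lam • u') z)) ^ 2) ∂D = 0 := by
        rw [lintegral_congr_ae (g := fun _ => 0), lintegral_zero]
        filter_upwards [hf'] with z hz
        simp [hz]
      rw [h0]
      gcongr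
      exact zero_le

end

/-! ### Runs and their rate of convergence -/

noncomputable section

variable {p q : ℕ} {μ : EuclideanSpace ℝ (JointIdx p q)}
  {S : Matrix (JointIdx p q) (JointIdx p q) ℝ} {D : Measure (Covariates p q × ℝ)}

/-- The scale `Aₜ = (|γ|² + Mᵗ |ε|²) / (|γ|² + M²ᵗ |ε|²)` of the model after `t` iterations. The
denominator vanishes only if `γ = 0`, `M = 0` and `t ≥ 1`; then the direction `γ + Mᵗ δ` is zero
and the value of the scale is immaterial. -/
def runScale (S : Matrix (JointIdx p q) (JointIdx p q) ℝ) (t : ℕ) : ℝ :=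
  (covForm S (gamVec S) (gamVec S) + ratioM S ^ t * covForm S (epsVec S) (epsVec S)) /
    (covForm S (gamVec S) (gamVec S) + (ratioM S ^ t) ^ 2 * covForm S (epsVec S) (epsVec S))

/-- The direction `Aₜ (γ + Mᵗ δ)` of the model after `t` iterations. -/
def runVec (S : Matrix (JointIdx p q) (JointIdx p q) ℝ) (t : ℕ) : JointIdx p q → ℝ :=
  runScale S t • (gamVec S + ratioM S ^ t • delVec S)

lemma runVec_idxY (t : ℕ) : runVec S t (idxY ()) = 0 := by
  simp [runVec, gamVec_idxY, delVec_idxY]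

lemma runVec_zero (hS : S.PosDef) : runVec S 0 = gamVec S + delVec S := by
  have hE := covForm_epsVec_self_pos hS
  have hG := covForm_self_nonneg hS (gamVec S)
  have h1 : runScale S 0 = 1 := by
    rw [runScale, pow_zero, one_pow]
    exact div_self (by linarith)
  simp [runVec, h1]

lemma runScale_pos (hS : S.PosDef) (hγ : gamVec S ≠ 0) (t : ℕ) : 0 < runScale S t := by
  have hE := covForm_epsVec_self_pos hS
  have hG := covForm_self_pos hS hγ
  have hM := ratioM_nonneg hS
  rw [runScale]
  positivity

/-- General position makes `δ` vanish together with `γ`. -/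
lemma delVec_eq_zero_of_gamVec (hS : S.PosDef)
    (hpos : S.submatrix idxΦ (idxY : Unit → JointIdx p q) = 0 →
      S.submatrix idxΨ (idxY : Unit → JointIdx p q) = 0) (hγ : gamVec S = 0) :
    delCoef S = 0 ∧ delVec S = 0 ∧ ratioM S = 0 := by
  have h0 := submatrix_idxΦ_idxY_eq_zero hS hγ
  have h1 := delCoef_eq_zero h0 (hpos h0)
  have h2 : delVec S = 0 := by simp [delVec, h1]
  exact ⟨h1, h2, by rw [ratioM_eq hS, h2]; simp⟩

/-- Decomposition of `a (γ + Mᵗ δ)` into its regression on `(Φ, Y)`, which is `a (γ + Mᵗ⁺¹ ε)`, and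
a combination of the grouping residuals. -/
lemma add_sum_smul_delCoef (hS : S.PosDef) (a : ℝ) (t : ℕ) :
    a • (gamVec S + ratioM S ^ (t + 1) • epsVec S) +
      ∑ j, ((a * ratioM S ^ t) • delCoef S) j • grpVec S j =
    a • (gamVec S + ratioM S ^ t • delVec S) := by
  have h : ∑ j, ((a * ratioM S ^ t) • delCoef S) j • grpVec S j =
      (a * ratioM S ^ t) • (delVec S - ratioM S • epsVec S) := by
    rw [← sum_delCoef_grpVec hS, Finset.smul_sum]
    exact Finset.sum_congr rfl fun j _ => by rw [Pi.smul_apply, smul_assoc]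
  rw [h, pow_succ]
  module

/-- The iteration maps the model `E[Y] + Aₜ (γ + Mᵗ δ)` to `E[Y] + Aₜ₊₁ (γ + Mᵗ⁺¹ δ)`. -/
lemma mcPseudolabelStep_runVec_iff [IsProbabilityMeasure D] (hS : S.PosDef)
    (hD : D.map jointVec = multivariateGaussian μ S)
    (hpos : S.submatrix idxΦ (idxY : Unit → JointIdx p q) = 0 →
      S.submatrix idxΨ (idxY : Unit → JointIdx p q) = 0)
    {f f' : Covariates p q → ℝ} (t : ℕ) (hfm : Measurable f)
    (hf : ∀ᵐ z ∂D, f z.1 = μ (idxY ()) + linStat μ (runVec S t) z) :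
    MCPseudolabelStep D (linearH2 D) (allPredictors (Covariates p q)) f f' ↔
      Measurable f' ∧ ∀ᵐ z ∂D, f' z.1 = μ (idxY ()) + linStat μ (runVec S (t + 1)) z := by
  set a := runScale S t with ha
  set b := ratioM S ^ (t + 1) with hb
  set u := a • (gamVec S + b • epsVec S) with hu
  set u' := a • (gamVec S + b • delVec S) with hu'
  set θ := (a * ratioM S ^ t) • delCoef S with hθ
  have huΨ (j : Fin q) : u (idxΨ j) = 0 := by simp [hu, gamVec_idxΨ, epsVec_idxΨ]
  have hu'Y : u' (idxY ()) = 0 := by simp [hu', gamVec_idxY, delVec_idxY]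
  have hort (x : JointIdx p q → ℝ) (hx : x (idxY ()) = 0) : covForm S (u - u') x = 0 := by
    have h : u - u' = (a * b) • (epsVec S - delVec S) := by
      rw [hu, hu']
      module
    rw [h, map_smul, LinearMap.smul_apply, covForm_eps_sub_del_of_idxY hS hx, smul_zero]
  rw [runVec, ← add_sum_smul_delCoef hS] at hf
  have hεγ := covForm_epsVec_gamVec hS
  have hγε := (covForm_symm hS (gamVec S) (epsVec S)).trans hεγ
  have hY : coordVec (idxY ()) = gamVec S + epsVec S := by rw [gamVec, sub_add_cancel]
  by_cases hγ : gamVec S = 0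
  -- If `γ = 0`, all models are the constant `E[Y]`; any `λ` will do.
  · obtain ⟨hd, hδ, hM⟩ := delVec_eq_zero_of_gamVec hS hpos hγ
    have hu0 : u = 0 := by simp [hu, hγ, hb, hM]
    have hθ0 : θ = 0 := by simp [hθ, hd]
    have hnext : runVec S (t + 1) = (0 : ℝ) • u' := by simp [runVec, hγ, hδ]
    rw [hnext]
    exact mcPseudolabelStep_iff hS hD huΨ (fun _ => hθ0) (by simp [hu0]) hu'Y hort hfm hf
  · have hG := covForm_self_pos hS hγ
    have hE := covForm_epsVec_self_pos hS
    have ha0 : 0 < a := runScale_pos hS hγ t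
    have hden : covForm S (gamVec S) (gamVec S) +
        b ^ 2 * covForm S (epsVec S) (epsVec S) ≠ 0 := by positivity
    -- Here `u` is never zero, since its covariance with `γ` is `a |γ|²`.
    have hdeg : u = 0 → θ = 0 := by
      intro h0
      exfalso
      have h1 : covForm S (gamVec S) u = a * covForm S (gamVec S) (gamVec S) := by
        simp [hu, hγε]
      rw [h0, map_zero] at h1
      exact (mul_pos ha0 hG).ne h1
    have hnext : runVec S (t + 1) = (runScale S (t + 1) / a) • u' := by
      rw [hu', smul_smul, div_mul_cancel₀ _ ha0.ne', runVec]
    have hlam : covForm S (coordVec (idxY ()) - (runScale S (t + 1) / a) • u) u = 0 := by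
      rw [hu, smul_smul, div_mul_cancel₀ _ ha0.ne', hY]
      simp only [map_add, map_sub, map_smul, LinearMap.add_apply, LinearMap.sub_apply,
        LinearMap.smul_apply, smul_eq_mul, hεγ, hγε, runScale, ← hb]
      field_simp
      ring
    rw [hnext]
    exact mcPseudolabelStep_iff hS hD huΨ hdeg hlam hu'Y hort hfm hf

/-- The models of every run are `E[Y] + Aₜ (γ + Mᵗ δ)`. -/
lemma isMCPseudolabelRun_iff [IsProbabilityMeasure D] (hS : S.PosDef)
    (hD : D.map jointVec = multivariateGaussian μ S)
    (hpos : S.submatrix idxΦ (idxY : Unit → JointIdx p q) = 0 →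
      S.submatrix idxΨ (idxY : Unit → JointIdx p q) = 0) (f : ℕ → Covariates p q → ℝ) :
    IsMCPseudolabelRun D (linearH2 D) (allPredictors (Covariates p q)) f ↔
      ∀ t, Measurable (f t) ∧
        ∀ᵐ z ∂D, f t z.1 = μ (idxY ()) + linStat μ (runVec S t) z := by
  have h0 := condExp_y_covariates hS hD
  rw [← runVec_zero hS] at h0
  constructor
  · rintro ⟨hm, hinit, hstep⟩ t
    induction t with
    | zero => exact ⟨hm, hinit.trans h0⟩
    | succ t ih => exact (mcPseudolabelStep_runVec_iff hS hD hpos t ih.1 ih.2).1 (hstep t)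
  · intro h
    refine ⟨(h 0).1, Filter.EventuallyEq.trans (h 0).2 h0.symm, fun t => ?_⟩
    exact (mcPseudolabelStep_runVec_iff hS hD hpos t (h t).1 (h t).2).2 (h (t + 1))

/-- Statistics of the covariates grow at most linearly. -/
lemma exists_abs_linStat_le (μ : EuclideanSpace ℝ (JointIdx p q)) {w : JointIdx p q → ℝ}
    (hw : w (idxY ()) = 0) :
    ∃ K : ℝ, 0 ≤ K ∧ ∀ z : Covariates p q × ℝ, |linStat μ w z| ≤ K * (1 + ‖z.1‖) := by
  refine ⟨‖WithLp.toLp 2 fun i => w (idxΦ i)‖ + ‖WithLp.toLp 2 fun j => w (idxΨ j)‖ +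
    |∑ k, w k * μ k|, by positivity, fun z => ?_⟩
  rw [linStat_eq_inner, hw, zero_mul, add_zero]
  have h1 := abs_real_inner_le_norm (WithLp.toLp 2 fun i => w (idxΦ i)) z.1.1
  have h2 := abs_real_inner_le_norm (WithLp.toLp 2 fun j => w (idxΨ j)) z.1.2
  have h3 := mul_le_mul_of_nonneg_left (norm_fst_le z.1)
    (norm_nonneg (WithLp.toLp 2 fun i => w (idxΦ i)))
  have h4 := mul_le_mul_of_nonneg_left (norm_snd_le z.1)
    (norm_nonneg (WithLp.toLp 2 fun j => w (idxΨ j)))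
  have h5 := abs_sub (inner ℝ (WithLp.toLp 2 fun i => w (idxΦ i)) z.1.1 +
    inner ℝ (WithLp.toLp 2 fun j => w (idxΨ j)) z.1.2) (∑ k, w k * μ k)
  have h6 := abs_add_le (inner ℝ (WithLp.toLp 2 fun i => w (idxΦ i)) z.1.1)
    (inner ℝ (WithLp.toLp 2 fun j => w (idxΨ j)) z.1.2)
  have h7 : 0 ≤ |∑ k, w k * μ k| * ‖z.1‖ := by positivity
  have h8 := norm_nonneg (WithLp.toLp 2 fun i => w (idxΦ i))
  have h9 := norm_nonneg (WithLp.toLp 2 fun j => w (idxΨ j))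
  nlinarith

lemma abs_runScale_sub_one_le (hS : S.PosDef) (hγ : gamVec S ≠ 0) (t : ℕ) :
    |runScale S t - 1| ≤
      covForm S (epsVec S) (epsVec S) / covForm S (gamVec S) (gamVec S) * ratioM S ^ t := by
  have hE := covForm_epsVec_self_pos hS
  have hG := covForm_self_pos hS hγ
  have hM := ratioM_nonneg hS
  set E := covForm S (epsVec S) (epsVec S)
  set G := covForm S (gamVec S) (gamVec S)
  set b := ratioM S ^ t with hb
  have hb0 : 0 ≤ b := pow_nonneg hM t
  have hb1 : b ≤ 1 := pow_le_one₀ hM (ratioM_lt_one hS).le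
  have hden : 0 < G + b ^ 2 * E := by positivity
  have h : runScale S t - 1 = (b - b ^ 2) * E / (G + b ^ 2 * E) := by
    rw [runScale, ← hb, div_sub_one hden.ne']
    ring
  have hnum : 0 ≤ (b - b ^ 2) * E := mul_nonneg (by nlinarith) hE.le
  rw [h, abs_of_nonneg (div_nonneg hnum hden.le), div_mul_eq_mul_div]
  refine div_le_div₀ (by positivity) ?_ hG (le_add_of_nonneg_right (by positivity))
  nlinarith [mul_nonneg (sq_nonneg b) hE.le]

/-- The models converge to `E[Y] + γ` at the rate `Mᵗ`, up to a factor growing at most linearly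
in `x`. If `γ = 0` then `δ = 0` as well, and all models are constant. -/
lemma exists_abs_linStat_runVec_sub_le (hS : S.PosDef) (μ : EuclideanSpace ℝ (JointIdx p q))
    (hpos : S.submatrix idxΦ (idxY : Unit → JointIdx p q) = 0 →
      S.submatrix idxΨ (idxY : Unit → JointIdx p q) = 0) :
    ∃ C : ℝ, ∀ (z : Covariates p q × ℝ) (t : ℕ),
      |linStat μ (runVec S t) z - linStat μ (gamVec S) z| ≤
        C * (1 + ‖z.1‖) * ratioM S ^ t := by
  by_cases hγ : gamVec S = 0
  · obtain ⟨-, hδ, -⟩ := delVec_eq_zero_of_gamVec hS hpos hγ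
    exact ⟨0, fun z t => by simp [runVec, hγ, hδ]⟩
  obtain ⟨K, hK, hKγ⟩ := exists_abs_linStat_le μ (gamVec_idxY S)
  obtain ⟨K', hK', hKδ⟩ := exists_abs_linStat_le μ (delVec_idxY S)
  have hr : 0 ≤ covForm S (epsVec S) (epsVec S) / covForm S (gamVec S) (gamVec S) :=
    div_nonneg (covForm_self_nonneg hS _) (covForm_self_nonneg hS _)
  set r := covForm S (epsVec S) (epsVec S) / covForm S (gamVec S) (gamVec S)
  refine ⟨r * K + (1 + r) * K', fun z t => ?_⟩
  have hM0 : 0 ≤ ratioM S ^ t := pow_nonneg (ratioM_nonneg hS) t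
  have hM1 : ratioM S ^ t ≤ 1 := pow_le_one₀ (ratioM_nonneg hS) (ratioM_lt_one hS).le
  have hA := abs_runScale_sub_one_le hS hγ t
  have hA' : runScale S t ≤ 1 + r := by
    have h1 := (abs_le.1 hA).2
    have h2 := mul_le_of_le_one_right hr hM1
    linarith
  have hA0 := (runScale_pos hS hγ t).le
  have hsplit : linStat μ (runVec S t) z - linStat μ (gamVec S) z =
      (runScale S t - 1) * linStat μ (gamVec S) z +
        runScale S t * ratioM S ^ t * linStat μ (delVec S) z := by
    simp only [runVec, map_add, map_smul, Pi.add_apply, Pi.smul_apply, smul_eq_mul]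
    ring
  calc |linStat μ (runVec S t) z - linStat μ (gamVec S) z|
      ≤ |runScale S t - 1| * |linStat μ (gamVec S) z| +
          runScale S t * ratioM S ^ t * |linStat μ (delVec S) z| := by
        rw [hsplit]
        refine (abs_add_le _ _).trans_eq ?_
        rw [abs_mul, abs_mul, abs_of_nonneg (mul_nonneg hA0 hM0)]
    _ ≤ r * ratioM S ^ t * (K * (1 + ‖z.1‖)) +
          (1 + r) * ratioM S ^ t * (K' * (1 + ‖z.1‖)) := by
        gcongr
        · exact hKγ z
        · exact hKδ z
    _ = (r * K + (1 + r) * K') * (1 + ‖z.1‖) * ratioM S ^ t := by ring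

end

theorem mainTheorem6 {p q : ℕ} (μ : EuclideanSpace ℝ (JointIdx p q))
    (S : Matrix (JointIdx p q) (JointIdx p q) ℝ) (hS : S.PosDef)
    (D : Measure (Covariates p q × ℝ)) [IsProbabilityMeasure D]
    (hD : D.map jointVec = multivariateGaussian μ S) :
    (0 ≤ ratioM S ∧ ratioM S < 1) ∧
    ((S.submatrix idxΦ idxY = 0 → S.submatrix idxΨ idxY = 0) →
      (∃ f : ℕ → Covariates p q → ℝ,
        IsMCPseudolabelRun D (linearH2 D) (allPredictors (Covariates p q)) f) ∧
      ∃ C : ℝ, ∀ f : ℕ → Covariates p q → ℝ,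
        IsMCPseudolabelRun D (linearH2 D) (allPredictors (Covariates p q)) f →
        ∀ g : EuclideanSpace ℝ (Fin p) → ℝ, Measurable g →
          (fun z : Covariates p q × ℝ => g z.1.1)
            =ᵐ[D] D[fun z : Covariates p q × ℝ => z.2 |
              MeasurableSpace.comap (fun z : Covariates p q × ℝ => z.1.1) inferInstance] →
          ∀ᵐ x ∂(D.map Prod.fst),
            Tendsto (fun t => f t x) atTop (𝓝 (g x.1)) ∧
            ∀ t, |f t x - g x.1| ≤ C * (1 + ‖x‖) * ratioM S ^ t) := by
  refine ⟨⟨ratioM_nonneg hS, ratioM_lt_one hS⟩, fun hpos => ⟨?_, ?_⟩⟩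
  · refine ⟨fun t x => μ (idxY ()) + linStat μ (runVec S t) (x, 0),
      (isMCPseudolabelRun_iff hS hD hpos _).2 fun t => ⟨?_, ?_⟩⟩
    · have hm := measurable_linStat μ (runVec S t)
      fun_prop
    · exact Eventually.of_forall fun z => by rw [linStat_eq_of_idxY (runVec_idxY t)]
  · obtain ⟨C, hC⟩ := exists_abs_linStat_runVec_sub_le hS μ hpos
    refine ⟨C, fun f hf g hgm hg => ?_⟩
    have hrun := (isMCPseudolabelRun_iff hS hD hpos f).1 hf
    have hgD : ∀ᵐ z ∂D, g z.1.1 = μ (idxY ()) + linStat μ (gamVec S) (z.1, 0) := by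
      filter_upwards [hg.trans (condExp_y_phi hS hD)] with z hz
      rw [hz, linStat_eq_of_idxY (gamVec_idxY S) z 0]
    have hgX : ∀ᵐ x ∂(D.map Prod.fst),
        g x.1 = μ (idxY ()) + linStat μ (gamVec S) (x, 0) := by
      have hm := measurable_linStat μ (gamVec S)
      exact (ae_map_iff measurable_fst.aemeasurable
        (measurableSet_eq_fun (by fun_prop) (by fun_prop))).2 hgD
    have hfX (t : ℕ) : ∀ᵐ x ∂(D.map Prod.fst),
        f t x = μ (idxY ()) + linStat μ (runVec S t) (x, 0) := by
      have hm := measurable_linStat μ (runVec S t)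
      have hmf := (hrun t).1
      refine (ae_map_iff measurable_fst.aemeasurable
        (measurableSet_eq_fun (by fun_prop) (by fun_prop))).2 ?_
      filter_upwards [(hrun t).2] with z hz
      rw [hz, linStat_eq_of_idxY (runVec_idxY t) z 0]
    filter_upwards [hgX, ae_all_iff.2 hfX] with x hgx hfx
    have hbound (t : ℕ) : |f t x - g x.1| ≤ C * (1 + ‖x‖) * ratioM S ^ t := by
      rw [hgx, hfx t, add_sub_add_left_eq_sub]
      exact hC (x, 0) t
    refine ⟨?_, hbound⟩
    have hlim : Tendsto (fun t => C * (1 + ‖x‖) * ratioM S ^ t) atTop (𝓝 0) := by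
      simpa using (tendsto_pow_atTop_nhds_zero_of_lt_one (ratioM_nonneg hS)
        (ratioM_lt_one hS)).const_mul (C * (1 + ‖x‖))
    rw [tendsto_iff_norm_sub_tendsto_zero]
    exact squeeze_zero (fun t => norm_nonneg _) hbound hlim
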